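/- **Setting.** Let $\mathcal S,\mathcal A$ be finite sets, $\mathcal P(\cdot\mid s,a)$ transition probabilities on $\mathcal S$, $r(s,a,s')$ rewards with $|r|\le R_{\max}$, $\gamma\in[0,1)$, $\eta>0$, and $\phi(s,a)\in\mathbb R^h$ features with $\|\phi(s,a)\|_2\le 1$ (in particular this holds if the matrix $\Phi$ with rows $\phi(s,a)^\top$ satisfies $\|\Phi\|_\infty\le1$). Let $\beta(\cdot\mid s)$ be a behaviour policy such that the chain $(S_k,A_k)$ on $\mathcal S\times\mathcal A$, with transitions $(s,a)\to(s',a')$ of probability $\mathcal P(s'\mid s,a)\,\beta(a'\mid s')$, is irreducible; let $d$ be its stationary distribution and $D=\mathrm{diag}(d)$. Put $$(\mathcal T\Phi\theta)(s,a)=\sum_{s'}\mathcal P(s'\mid s,a)\Big(r(s,a,s')+\gamma\max_u\phi(s',u)^\top\theta\Big),\qquad L_\eta(\theta,\theta')=\tfrac12\|\mathcal T\Phi\theta'-\Phi\theta\|_D^2+\tfrac\eta2\|\theta\|_2^2,$$ let $\nabla L_\eta$ be the gradient in the first argument, $\theta^*(\theta')=\arg\min_\theta L_\eta(\theta,\theta')$,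 and let $\theta^*_\eta$ be a solution of the regularized projected Bellman equation $\theta^*_\eta=(\Phi^\top D\Phi+\eta I)^{-1}\Phi^\top D\,\mathcal T\Phi\theta^*_\eta$. Let $$g(\theta,\theta';s,a,s')=-\Big(r(s,a,s')+\gamma\max_u\phi(s',u)^\top\theta'-\phi(s,a)^\top\theta\Big)\phi(s,a)+\eta\theta,\qquad \bar g(\theta,\theta';s,a)=\sum_{s'}\mathcal P(s'\mid s,a)\,g(\theta,\theta';s,a,s').$$ With $\tau(y)=\inf\{n\ge1:(S_n,A_n)=y\}$ let $\tau_{\max}=\max_{x,y}\mathbb E[\tau(y)\mid(S_0,A_0)=x]$ over all state-action pairs $x,y$, and for an arbitrary fixed pair $(\tilde s,\tilde a)$ let $$V(\theta,\theta',s,a)=\mathbb E\Big[\sum_{k=0}^{\tau(\tilde s,\tilde a)-1}\big(\bar g(\theta,\theta';S_k,A_k)-\nabla L_\eta(\theta,\theta')\big)\,\Big|\,(S_0,A_0)=(s,a)\Big].$$ **Constants.** $\mu_\eta=\lambda_{\min}(\Phi^\top D\Phi)+\eta$, $l_\eta=\lambda_{\max}(\Phi^\top D\Phi)+\eta$, $\kappa=l_\eta/\mu_\eta$;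 $l_{V_1}=2\tau_{\max}(1+\eta)$, $l_{V_2}=\max\{2\tau_{\max}\gamma,1\}$, $l_{V_3}=\tau_{\max}(R_{\max}+(1+\gamma+\eta)\|\theta^*_\eta\|_2)$; $D_1=l_\eta(6l_{V_1}+l_{V_3})+\kappa l_{V_1}\gamma$, $D_2=4\kappa l_{V_1}(1+l_\eta)$, $D_3=\kappa l_{V_1}+l_\eta l_{V_2}$; $g_{1,\eta}=16+16\eta$, $g_{2,\eta}=(42+32\eta)\gamma^2$, $g_{3,\eta}=32(1+\eta)\gamma^2\|\Phi\theta^*_\eta\|_\infty^2+(16+16\eta)R_{\max}^2+8\sigma_\eta^2$, where $$\sigma_\eta^2=\max_{s,a}\ \mathbb E_{s'\sim\mathcal P(\cdot\mid s,a)}\Big\|\Big(r(s,a,s')+\gamma\max_u\phi(s',u)^\top\theta^*_\eta-(\mathcal T\Phi\theta^*_\eta)(s,a)\Big)\phi(s,a)\Big\|_2^2 ;$$ $\mathcal E_1=(D_1+\tfrac{l_\eta}2)g_{2,\eta}+D_3$ and $\mathcal E_2=(D_1+\tfrac{l_\eta}2)g_{3,\eta}+2l_\eta l_{V_3}$. **Iteration.**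 Let $\theta_{0,K}$ be a square-integrable random initial parameter. For $t\ge1$ put $\theta_{t,0}=\theta_{t-1,K}$ and, for $0\le k<K$, $\theta_{t,k+1}=\theta_{t,k}-\alpha_k\,g(\theta_{t,k},\theta_{t-1,K};s_{t,k},a_{t,k},s_{t,k+1})$. Let $\mathcal F_{t,k}$ be the $\sigma$-algebra generated by $\theta_{0,K}$, the pairs $(s_{i,j},a_{i,j})$ with $1\le i<t$, $0\le j\le K$, and the pairs $(s_{t,j},a_{t,j})$ with $0\le j\le k$. The samples are Markovian: for $t\ge 1$ and $0\le k<K$, given $\mathcal F_{t,k}$ the pair $(s_{t,k+1},a_{t,k+1})$ is distributed according to the transition probabilities of the chain from $(s_{t,k},a_{t,k})$ (for example, one trajectory continued through all outer rounds). Put $d_{t,k}=\nabla L_\eta(\theta_{t,k},\theta_{t-1,K})^\top V(\theta_{t,k},\theta_{t,0},s_{t,k},a_{t,k})$. **Proposition (descent lemma for the inner loop).** Let $t\ge1$, $0\le k<K$ and $0\le\alpha_k\le\dfrac{\mu_\eta}{(D_1+\frac{l_\eta}2)g_{1,\eta}+2D_2}$. Then $L_\eta(\theta_{t,k+1},\theta_{t-1,K})$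 and $d_{t,k+1}$ are integrable and, almost surely, $$\begin{aligned}\mathbb E[L_\eta(\theta_{t,k+1},\theta_{t-1,K})\mid\mathcal F_{t,k}]-L_\eta(\theta_{t,k},\theta_{t-1,K})\le{}&-\alpha_k\big(d_{t,k}-\mathbb E[d_{t,k+1}\mid\mathcal F_{t,k}]\big)\\&-\mu_\eta\alpha_k\big(L_\eta(\theta_{t,k},\theta_{t-1,K})-L_\eta(\theta^*(\theta_{t-1,K}),\theta_{t-1,K})\big)\\&+\alpha_k^2\big(\mathcal E_1\|\Phi(\theta_{t-1,K}-\theta^*_\eta)\|_\infty^2+\mathcal E_2\big).\end{aligned}$$ -/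

import Mathlib

open MeasureTheory ProbabilityTheory
open scoped Matrix

noncomputable section

namespace PRQ

/-- The data of a finite Markov decision process with linear features in `ℝ^h`: transition
probabilities `𝒫(· ∣ s, a)`, reward `r(s, a, s')`, behaviour policy `β(· ∣ s)`, features
`φ(s, a)`, discount factor `γ` and regularization parameter `η`. -/
structure Model (S A : Type*) (h : ℕ) where
  trans : S → A → PMF S
  reward : S → A → S → ℝ
  behav : S → PMF A
  feat : S → A → EuclideanSpace ℝ (Fin h)
  γ : ℝ
  η : ℝ

namespace Model

variable {S A : Type*} {h : ℕ} (M : Model S A h)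

/-! ### The state-action Markov chain under the behaviour policy -/

/-- One step of the state-action chain: from `(s, a)` draw `s' ∼ 𝒫(· ∣ s, a)` and then
`a' ∼ β(· ∣ s')`. -/
def step (x : S × A) : PMF (S × A) :=
  (M.trans x.1 x.2).bind fun s' => (M.behav s').map fun a' => (s', a')

/-- The transition matrix of the state-action chain. -/
def stepMatrix : Matrix (S × A) (S × A) ℝ := fun x y => (M.step x y).toReal

/-- `d` is a stationary distribution of the state-action chain. -/
def IsStationary (d : PMF (S × A)) : Prop := d.bind M.step = d

section Chain

variable [Finite S] [Finite A]
  [MeasurableSpace S] [DiscreteMeasurableSpace S] [MeasurableSpace A] [DiscreteMeasurableSpace A]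

/-- The transition probabilities of the state-action chain as a Markov kernel. -/
def stepKernel : Kernel (S × A) (S × A) :=
  Kernel.ofFunOfCountable fun x => (M.step x).toMeasure

instance : IsMarkovKernel M.stepKernel :=
  ⟨fun x => inferInstanceAs (IsProbabilityMeasure (M.step x).toMeasure)⟩

/-- The same transition probabilities, as kernels from the history up to time `n` to the
position at time `n + 1`. -/
def historyKernel (n : ℕ) :
    Kernel (Π _ : Finset.Iic n, S × A) (S × A) :=
  M.stepKernel.comap (fun w => w ⟨n, Finset.mem_Iic.2 le_rfl⟩) (measurable_pi_apply _)

instance (n : ℕ) : IsMarkovKernel (M.historyKernel n) := by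
  unfold historyKernel; infer_instance

/-- The law of the whole trajectory `(S₀, A₀), (S₁, A₁), …` of the state-action chain started at
`(S₀, A₀) = x`. -/
def pathLaw (x : S × A) : Measure (ℕ → S × A) :=
  Kernel.traj (X := fun _ => S × A) M.historyKernel 0 (fun _ => x)

/-- The hitting time `τ(y) = inf {n ≥ 1 : (Sₙ, Aₙ) = y}` along a trajectory. -/
def hitTime (y : S × A) (w : ℕ → S × A) : ℕ := sInf {n | 1 ≤ n ∧ w n = y}

/-- `τ_max`: the largest expected hitting time `max_{x, y} 𝔼[τ(y) ∣ (S₀, A₀) = x]`. -/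
def tauMax : ℝ :=
  ⨆ p : (S × A) × (S × A), ∫ w, (hitTime p.2 w : ℝ) ∂M.pathLaw p.1

end Chain

/-! ### Loss functions and the stochastic gradient -/

/-- `(Φ θ)(s, a) = φ(s, a)ᵀ θ`. -/
def lin (θ : EuclideanSpace ℝ (Fin h)) : S × A → ℝ := fun x => inner ℝ (M.feat x.1 x.2) θ

/-- `max_u φ(s, u)ᵀ θ`. -/
def maxVal (θ : EuclideanSpace ℝ (Fin h)) (s : S) : ℝ := ⨆ u : A, inner ℝ (M.feat s u) θ

/-- The stochastic gradient
`g(θ, θ'; s, a, s') = (r(s,a,s') + γ max_u φ(s',u)ᵀθ' - φ(s,a)ᵀθ) (-φ(s,a)) + η θ`. -/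
def sgrad (θ θ' : EuclideanSpace ℝ (Fin h)) (x : S × A) (s' : S) : EuclideanSpace ℝ (Fin h) :=
  (M.reward x.1 x.2 s' + M.γ * M.maxVal θ' s' - inner ℝ (M.feat x.1 x.2) θ) •
    (-M.feat x.1 x.2) + M.η • θ

variable [Fintype S] [Fintype A]

/-- The Bellman optimality operator applied to `Φ θ`:
`(𝒯 Φ θ)(s, a) = ∑_{s'} 𝒫(s' ∣ s, a) (r(s,a,s') + γ max_u φ(s',u)ᵀθ)`. -/
def bellman (θ : EuclideanSpace ℝ (Fin h)) : S × A → ℝ := fun x =>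
  ∑ s' : S, (M.trans x.1 x.2 s').toReal * (M.reward x.1 x.2 s' + M.γ * M.maxVal θ s')

/-- The inner loss `L_η(θ, θ') = ½ ‖𝒯Φθ' - Φθ‖²_D + (η/2) ‖θ‖²`, where `D = diag(d)`. -/
def loss (d : PMF (S × A)) (θ θ' : EuclideanSpace ℝ (Fin h)) : ℝ :=
  (1 / 2) * ∑ x : S × A, (d x).toReal * (M.bellman θ' x - M.lin θ x) ^ 2 + M.η / 2 * ‖θ‖ ^ 2

/-- The gradient `∇ L_η(θ, θ')` in the first argument. -/
def lossGrad (d : PMF (S × A)) (θ θ' : EuclideanSpace ℝ (Fin h)) : EuclideanSpace ℝ (Fin h) :=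
  gradient (fun v => M.loss d v θ') θ

/-- `θ*(θ') = argmin_θ L_η(θ, θ')`. -/
def innerArgmin (d : PMF (S × A)) (θ' : EuclideanSpace ℝ (Fin h)) : EuclideanSpace ℝ (Fin h) :=
  Classical.epsilon fun v => ∀ u, M.loss d v θ' ≤ M.loss d u θ'

/-- `ḡ(θ, θ'; s, a) = ∑_{s'} 𝒫(s' ∣ s, a) g(θ, θ'; s, a, s')`. -/
def meanGrad (θ θ' : EuclideanSpace ℝ (Fin h)) (x : S × A) : EuclideanSpace ℝ (Fin h) :=
  ∑ s' : S, (M.trans x.1 x.2 s').toReal • M.sgrad θ θ' x s'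

/-- The solution of Poisson's equation with reference pair `y = (s̃, ã)`:
`V(θ, θ', x) = 𝔼[∑_{k=0}^{τ(y)-1} (ḡ(θ, θ'; Sₖ, Aₖ) - ∇L_η(θ, θ')) ∣ (S₀, A₀) = x]`. -/
def poisson [MeasurableSpace S] [DiscreteMeasurableSpace S] [MeasurableSpace A]
    [DiscreteMeasurableSpace A] (d : PMF (S × A)) (y : S × A)
    (θ θ' : EuclideanSpace ℝ (Fin h)) (x : S × A) : EuclideanSpace ℝ (Fin h) :=
  ∫ w, ∑ k ∈ Finset.range (hitTime y w), (M.meanGrad θ θ' (w k) - M.lossGrad d θ θ')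
    ∂M.pathLaw x

/-! ### Feature matrix and regularized projected Bellman equation -/

/-- The feature matrix `Φ`, with rows `φ(s, a)ᵀ`. -/
def featMatrix : Matrix (S × A) (Fin h) ℝ := fun x i => M.feat x.1 x.2 i

open scoped Classical in
/-- `Φᵀ D`. -/
def featD (d : PMF (S × A)) : Matrix (Fin h) (S × A) ℝ :=
  M.featMatrixᵀ * Matrix.diagonal fun x => (d x).toReal

/-- `Φᵀ D Φ`. -/
def gram (d : PMF (S × A)) : Matrix (Fin h) (Fin h) ℝ := M.featD d * M.featMatrix

/-- `(Φᵀ D Φ + η I)⁻¹ Φᵀ D`. -/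
def regSolve (d : PMF (S × A)) : Matrix (Fin h) (S × A) ℝ :=
  (M.gram d + M.η • (1 : Matrix (Fin h) (Fin h) ℝ))⁻¹ * M.featD d

/-- The regularized projection `Γ_η = Φ (Φᵀ D Φ + η I)⁻¹ Φᵀ D`. -/
def regProj (d : PMF (S × A)) : Matrix (S × A) (S × A) ℝ := M.featMatrix * M.regSolve d

/-- `θ` is a solution `θ*_η` of the regularized projected Bellman equation, in parameter form
`θ = (Φᵀ D Φ + η I)⁻¹ Φᵀ D 𝒯 Φ θ`. -/
def IsRPBESolution (d : PMF (S × A)) (θ : EuclideanSpace ℝ (Fin h)) : Prop :=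
  θ.ofLp = M.regSolve d *ᵥ M.bellman θ

/-- For a feature matrix of full column rank the parameter form agrees with
`Φ θ = Γ_η 𝒯 Φ θ`. -/
theorem isRPBESolution_iff (d : PMF (S × A)) (hΦ : Function.Injective M.featMatrix.mulVec)
    (θ : EuclideanSpace ℝ (Fin h)) :
    M.IsRPBESolution d θ ↔ M.lin θ = M.regProj d *ᵥ M.bellman θ := by
  have hlin : M.lin θ = M.featMatrix *ᵥ θ.ofLp := by
    funext x
    simp [lin, featMatrix, Matrix.mulVec, dotProduct, PiLp.inner_apply, mul_comm]
  rw [hlin, regProj, ← Matrix.mulVec_mulVec, hΦ.eq_iff, IsRPBESolution]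

/-! ### Constants -/

/-- `μ_η = λ_min(Φᵀ D Φ) + η`. -/
def mu (d : PMF (S × A)) : ℝ := sInf (spectrum ℝ (M.gram d)) + M.η

/-- `l_η = λ_max(Φᵀ D Φ) + η`. -/
def ell (d : PMF (S × A)) : ℝ := sSup (spectrum ℝ (M.gram d)) + M.η

/-- The condition number `κ = l_η / μ_η`. -/
def kappa (d : PMF (S × A)) : ℝ := M.ell d / M.mu d

/-- `σ_η² = max_{s,a} 𝔼[‖(r(s,a,s') + γ max_u φ(s',u)ᵀθ*_η
  - 𝔼[r(s,a,s̃) + γ max_u φ(s̃,u)ᵀθ*_η]) φ(s,a)‖² ∣ s, a]`. -/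
def sigmaSq (θs : EuclideanSpace ℝ (Fin h)) : ℝ :=
  ⨆ x : S × A, ∑ s' : S, (M.trans x.1 x.2 s').toReal *
    ‖(M.reward x.1 x.2 s' + M.γ * M.maxVal θs s' - M.bellman θs x) • M.feat x.1 x.2‖ ^ 2

/-- `g_{1,η} = 16 + 16 η`. -/
def g1 : ℝ := 16 + 16 * M.η

/-- `g_{2,η} = (42 + 32 η) γ²`. -/
def g2 : ℝ := (42 + 32 * M.η) * M.γ ^ 2

/-- `g_{3,η} = 32 (1 + η) γ² ‖Φ θ*_η‖_∞² + (16 + 16 η) R_max² + 8 σ_η²`. -/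
def g3 (Rmax : ℝ) (θs : EuclideanSpace ℝ (Fin h)) : ℝ :=
  32 * (1 + M.η) * M.γ ^ 2 * ‖M.lin θs‖ ^ 2 + (16 + 16 * M.η) * Rmax ^ 2 + 8 * M.sigmaSq θs

section ChainConstants

variable [MeasurableSpace S] [DiscreteMeasurableSpace S]
  [MeasurableSpace A] [DiscreteMeasurableSpace A]

/-- `l_{V₁} = 2 τ_max (1 + η)`. -/
def lV1 : ℝ := 2 * M.tauMax * (1 + M.η)

/-- `l_{V₂} = max {2 τ_max γ, 1}`. -/
def lV2 : ℝ := max (2 * M.tauMax * M.γ) 1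

/-- `l_{V₃} = τ_max (R_max + (1 + γ + η) ‖θ*_η‖₂)`. -/
def lV3 (Rmax : ℝ) (θs : EuclideanSpace ℝ (Fin h)) : ℝ :=
  M.tauMax * (Rmax + (1 + M.γ + M.η) * ‖θs‖)

/-- `D₁ = l_η (6 l_{V₁} + l_{V₃}) + κ l_{V₁} γ`. -/
def D1 (d : PMF (S × A)) (Rmax : ℝ) (θs : EuclideanSpace ℝ (Fin h)) : ℝ :=
  M.ell d * (6 * M.lV1 + M.lV3 Rmax θs) + M.kappa d * M.lV1 * M.γ

/-- `D₂ = κ (4 l_{V₁} (1 + l_η))`. -/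
def D2 (d : PMF (S × A)) : ℝ := M.kappa d * (4 * M.lV1 * (1 + M.ell d))

/-- `D₃ = κ l_{V₁} + l_η l_{V₂}`. -/
def D3 (d : PMF (S × A)) : ℝ := M.kappa d * M.lV1 + M.ell d * M.lV2

/-- `ℰ₁ = (D₁ + l_η / 2) g_{2,η} + D₃`. -/
def E1 (d : PMF (S × A)) (Rmax : ℝ) (θs : EuclideanSpace ℝ (Fin h)) : ℝ :=
  (M.D1 d Rmax θs + M.ell d / 2) * M.g2 + M.D3 d

/-- `ℰ₂ = (D₁ + l_η / 2) g_{3,η} + 2 l_η l_{V₃}`. -/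
def E2 (d : PMF (S × A)) (Rmax : ℝ) (θs : EuclideanSpace ℝ (Fin h)) : ℝ :=
  (M.D1 d Rmax θs + M.ell d / 2) * M.g3 Rmax θs + 2 * M.ell d * M.lV3 Rmax θs

end ChainConstants

end Model

/-! ### The double-loop iteration -/

section Iteration

variable {S A : Type*} {h : ℕ} (M : Model S A h)

/-- The inner loop with target `θ'`, step sizes `α` and state-action pairs `x 0, x 1, …`:
`θ_0 = θ'` and `θ_{k+1} = θ_k - α_k g(θ_k, θ'; s_k, a_k, s_{k+1})`. -/
def innerIter (α : ℕ → ℝ) (θ' : EuclideanSpace ℝ (Fin h)) (x : ℕ → S × A) :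
    ℕ → EuclideanSpace ℝ (Fin h)
  | 0 => θ'
  | k + 1 => innerIter α θ' x k - α k • M.sgrad (innerIter α θ' x k) θ' (x k) (x (k + 1)).1

/-- The outer iterates `θ_{t,K}`, where `x t k = (s_{t,k}, a_{t,k})` is used for `t ≥ 1` and
`θ_{0,K} = θ₀` is the initial parameter. -/
def outerIter (α : ℕ → ℝ) (K : ℕ) (θ₀ : EuclideanSpace ℝ (Fin h)) (x : ℕ → ℕ → S × A) :
    ℕ → EuclideanSpace ℝ (Fin h)
  | 0 => θ₀
  | t + 1 => innerIter M α (outerIter α K θ₀ x t) (x (t + 1)) K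

/-- The iterate `θ_{t,k}` for `t ≥ 1`, which starts from `θ_{t,0} = θ_{t-1,K}`. -/
def iter (α : ℕ → ℝ) (K : ℕ) (θ₀ : EuclideanSpace ℝ (Fin h)) (x : ℕ → ℕ → S × A) (t k : ℕ) :
    EuclideanSpace ℝ (Fin h) :=
  innerIter M α (outerIter M α K θ₀ x (t - 1)) (x t) k

/-- The information `ℱ_{t,k}`: the initial parameter and all state-action pairs observed in the
outer rounds `1, …, t - 1` (inner times `0, …, K`) and in round `t` up to inner time `k`. -/
abbrev info {Ω : Type*} [MeasurableSpace S] [MeasurableSpace A] (K : ℕ)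
    (θ₀ : Ω → EuclideanSpace ℝ (Fin h)) (x : ℕ → ℕ → Ω → S × A) (t k : ℕ) : MeasurableSpace Ω :=
  MeasurableSpace.comap θ₀ inferInstance ⊔
    ⨆ p ∈ {p : ℕ × ℕ | 1 ≤ p.1 ∧ (p.1 < t ∧ p.2 ≤ K ∨ p.1 = t ∧ p.2 ≤ k)},
      MeasurableSpace.comap (x p.1 p.2) inferInstance

/-- `(s_{t,k}, a_{t,k})`, `0 ≤ k ≤ K`, is within every outer round `t ≥ 1` a trajectory of the
state-action chain: given `ℱ_{t,k}`, the pair at inner time `k + 1` is distributed according to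
the transition probabilities from the pair at inner time `k`. -/
def IsMarkovSampling {Ω : Type*} [MeasurableSpace Ω] [MeasurableSpace S] [MeasurableSpace A]
    (P : Measure Ω) (K : ℕ) (θ₀ : Ω → EuclideanSpace ℝ (Fin h)) (x : ℕ → ℕ → Ω → S × A) : Prop :=
  (∀ t k, Measurable (x t k)) ∧
    ∀ t k, 1 ≤ t → k < K → ∀ y : S × A,
      P[(x t (k + 1) ⁻¹' {y}).indicator (fun _ => (1 : ℝ)) | info K θ₀ x t k]
        =ᵐ[P] fun ω => M.stepMatrix (x t k ω) y

/-- `d_{t,k} = ∇L_η(θ_{t,k}, θ_{t-1,K})ᵀ V(θ_{t,k}, θ_{t,0}, s_{t,k}, a_{t,k})`, with reference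
pair `y` in the definition of `V`. -/
def driftTerm [Fintype S] [Fintype A] [MeasurableSpace S] [DiscreteMeasurableSpace S]
    [MeasurableSpace A] [DiscreteMeasurableSpace A] (d : PMF (S × A)) (y : S × A)
    (α : ℕ → ℝ) (K : ℕ) (θ₀ : EuclideanSpace ℝ (Fin h)) (x : ℕ → ℕ → S × A) (t k : ℕ) : ℝ :=
  inner ℝ (M.lossGrad d (iter M α K θ₀ x t k) (outerIter M α K θ₀ x (t - 1)))
    (M.poisson d y (iter M α K θ₀ x t k) (iter M α K θ₀ x t 0) (x t k))

end Iteration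

end PRQ

end

/-! For a fixed target `θ'` the loss is quadratic in `θ`, with Hessian N = ΦᵀDΦ + ηI (`reg`), and ⟨N
v, v⟩ lies between μ‖v‖² and l‖v‖². Given the history, only the next state-action pair is random, so
the claim reduces to an average over one transition, `expected_descent`. `condExp_apply_of_finite`
turns that average into conditional expectations.

The Markovian bias ḡ - ∇L is removed by Poisson's equation (`poisson_step`): it equals V at the
current pair minus the mean of V at the next pair. Hence the mean of ⟨∇L, g⟩ is ‖∇L‖² plus a
difference of drift terms, except that the term at the next pair still uses the old parameter. Both
∇L and V are affine in `θ`, so moving to the new parameter is exact: `loss_step` is an identity, and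
every error sits in `remainder`, multiplied by α².

To bound V, it is written as a sum over the occupation measure of an excursion ending at the
reference pair. `occupation_formula` expresses the density of that measure with respect to the
stationary law d through mean hitting times, so the density is at most 2τ_max. This yields the L²(d)
bound `sq_norm_occupation_sum_centred_le`, which measures V by energies instead of sup norms.

Finally write θ = θm + v, where θm minimizes the loss, so that ∇L = N v. Quantities at θm are
controlled by a bound m on the sampled Bellman target, through the energy identity of ridge
regression. Errors in v are absorbed by half of ‖∇L‖² under the step-size condition
(`step_error_le`). The other half is at least μ(L - L*), because ‖N v‖² ≥ μ⟨N v, v⟩ and L - L* = ⟨N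
v, v⟩/2. The terms in m that are left over fit into ℰ₁ and ℰ₂ (`budget_le`). -/

noncomputable section

namespace PRQ

/-! ### Finite Markov chains killed at a state -/

section Killed

variable {X : Type*} [DecidableEq X] {P : Matrix X X ℝ}

/-- The transition matrix `P` with the transitions into `y` removed. -/
def killed (P : Matrix X X ℝ) (y : X) : Matrix X X ℝ := fun x z => if z = y then 0 else P x z

lemma killed_nonneg (h0 : ∀ x z, 0 ≤ P x z) (y x z : X) : 0 ≤ killed P y x z := by
  unfold killed; split_ifs <;> simp [h0]

lemma killed_le (h0 : ∀ x z, 0 ≤ P x z) (y x z : X) : killed P y x z ≤ P x z := by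
  unfold killed; split_ifs <;> simp [h0]

variable [Fintype X]

/-- The expected number of visits to `z` before the first return to `y`, started at `x`. -/
def occupation (P : Matrix X X ℝ) (y x z : X) : ℝ := ∑' k : ℕ, (killed P y ^ k) x z

/-- The expected time of the first return to `y`, started at `x`. -/
def meanHit (P : Matrix X X ℝ) (y x : X) : ℝ := ∑ z, occupation P y x z

lemma pow_nonneg_entry {A : Matrix X X ℝ} (h0 : ∀ x z, 0 ≤ A x z) (k : ℕ) (x z : X) :
    0 ≤ (A ^ k) x z := by
  induction k generalizing x z with
  | zero => rw [pow_zero, Matrix.one_apply]; split_ifs <;> norm_num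
  | succ k ih =>
    rw [pow_succ, Matrix.mul_apply]
    exact Finset.sum_nonneg fun j _ => mul_nonneg (ih _ _) (h0 _ _)

lemma sum_pow_entry (h1 : ∀ x, ∑ z, P x z = 1) (k : ℕ) (x : X) : ∑ z, (P ^ k) x z = 1 := by
  induction k generalizing x with
  | zero => simp [Matrix.one_apply]
  | succ k ih =>
    simp only [pow_succ, Matrix.mul_apply]
    rw [Finset.sum_comm]
    simp only [← Finset.mul_sum, h1, mul_one, ih]

lemma killed_pow_le (h0 : ∀ x z, 0 ≤ P x z) (y : X) (k : ℕ) (x z : X) :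
    (killed P y ^ k) x z ≤ (P ^ k) x z := by
  induction k generalizing x z with
  | zero => simp
  | succ k ih =>
    simp only [pow_succ, Matrix.mul_apply]
    exact Finset.sum_le_sum fun j _ => mul_le_mul (ih _ _) (killed_le h0 _ _ _)
      (killed_nonneg h0 _ _ _) (pow_nonneg_entry h0 _ _ _)

lemma killed_pow_target (y : X) {k : ℕ} (hk : 0 < k) (x : X) : (killed P y ^ k) x y = 0 := by
  obtain ⟨k, rfl⟩ := Nat.exists_eq_succ_of_ne_zero hk.ne'
  simp [pow_succ, Matrix.mul_apply, killed]

/-- The total mass of the killed chain after `k` steps. -/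
def killedMass (P : Matrix X X ℝ) (y : X) (k : ℕ) (x : X) : ℝ := ∑ z, (killed P y ^ k) x z

lemma killedMass_nonneg (h0 : ∀ x z, 0 ≤ P x z) (y : X) (k : ℕ) (x : X) :
    0 ≤ killedMass P y k x :=
  Finset.sum_nonneg fun _ _ => pow_nonneg_entry (killed_nonneg h0 y) _ _ _

lemma killedMass_add (y : X) (j k : ℕ) (x : X) :
    killedMass P y (j + k) x = ∑ z, (killed P y ^ j) x z * killedMass P y k z := by
  simp only [killedMass, pow_add, Matrix.mul_apply, Finset.mul_sum]
  exact Finset.sum_comm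

lemma killedMass_le_one (h0 : ∀ x z, 0 ≤ P x z) (h1 : ∀ x, ∑ z, P x z = 1) (y : X) (k : ℕ)
    (x : X) : killedMass P y k x ≤ 1 := by
  rw [← sum_pow_entry h1 k x]
  exact Finset.sum_le_sum fun z _ => killed_pow_le h0 _ _ _ _

lemma killedMass_lt_one (h0 : ∀ x z, 0 ≤ P x z) (h1 : ∀ x, ∑ z, P x z = 1) {y : X} {k : ℕ}
    (hk : 0 < k) {x : X} (hpos : 0 < (P ^ k) x y) : killedMass P y k x < 1 := by
  rw [← sum_pow_entry h1 k x]
  refine Finset.sum_lt_sum (fun z _ => killed_pow_le h0 _ _ _ _) ⟨y, Finset.mem_univ _, ?_⟩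
  rwa [killed_pow_target y hk]

lemma killedMass_antitone (h0 : ∀ x z, 0 ≤ P x z) (h1 : ∀ x, ∑ z, P x z = 1) (y x : X) :
    Antitone fun k => killedMass P y k x := by
  refine antitone_nat_of_succ_le fun k => ?_
  rw [killedMass_add y k 1]
  exact Finset.sum_le_sum fun z _ => mul_le_of_le_one_right
    (pow_nonneg_entry (killed_nonneg h0 y) _ _ _) (killedMass_le_one h0 h1 _ _ _)

/-- From every start some power of `P` charges `y`, which makes the killed mass strictly less than
one. The mass decreases in time, so the sum of these finitely many times is a common horizon, and
the maximum over starts is still below one. -/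
lemma exists_killedMass_le (h0 : ∀ x z, 0 ≤ P x z) (h1 : ∀ x, ∑ z, P x z = 1)
    (hirr : P.IsIrreducible) (y : X) :
    ∃ (n : ℕ) (ρ : ℝ), 0 ≤ ρ ∧ ρ < 1 ∧ ∀ x, killedMass P y n x ≤ ρ := by
  have hpow := (Matrix.isIrreducible_iff_exists_pow_pos h0).1 hirr
  choose k hk hkpos using fun x => hpow x y
  have hlt : ∀ x, killedMass P y (∑ x, k x) x < 1 := fun x =>
    (killedMass_antitone h0 h1 y x (Finset.single_le_sum (fun _ _ => Nat.zero_le _)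
      (Finset.mem_univ x))).trans_lt (killedMass_lt_one h0 h1 (hk x) (hkpos x))
  have hne : (Finset.univ : Finset X).Nonempty := ⟨y, Finset.mem_univ _⟩
  obtain ⟨x₀, -, hx₀⟩ := Finset.exists_max_image Finset.univ
    (fun x => killedMass P y (∑ x, k x) x) hne
  exact ⟨_, _, killedMass_nonneg h0 _ _ x₀, hlt x₀, fun x => hx₀ x (Finset.mem_univ _)⟩

/-- The mass contracts by `ρ` every `n` steps, so each partial sum Σ satisfies Σ ≤ n + ρ Σ. This
bounds Σ by n / (1 - ρ) with no need to cut time into blocks. -/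
lemma summable_killedMass (h0 : ∀ x z, 0 ≤ P x z) (h1 : ∀ x, ∑ z, P x z = 1)
    (hirr : P.IsIrreducible) (y x : X) : Summable fun k => killedMass P y k x := by
  obtain ⟨n, ρ, hρ0, hρ1, hn⟩ := exists_killedMass_le h0 h1 hirr y
  refine summable_of_sum_range_le (c := n / (1 - ρ)) (fun k => killedMass_nonneg h0 _ _ _) ?_
  intro m
  have hstep : ∀ k, killedMass P y (k + n) x ≤ ρ * killedMass P y k x := by
    intro k
    rw [killedMass_add, killedMass, Finset.mul_sum]
    refine Finset.sum_le_sum fun z _ => ?_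
    rw [mul_comm]
    exact mul_le_mul_of_nonneg_right (hn z) (pow_nonneg_entry (killed_nonneg h0 y) _ _ _)
  have hle : ∑ k ∈ Finset.range m, killedMass P y k x
      ≤ n + ρ * ∑ k ∈ Finset.range m, killedMass P y k x := by
    calc ∑ k ∈ Finset.range m, killedMass P y k x
        ≤ ∑ k ∈ Finset.range (n + m), killedMass P y k x :=
          Finset.sum_le_sum_of_subset_of_nonneg (Finset.range_mono (by omega))
            fun k _ _ => killedMass_nonneg h0 _ _ _
      _ = ∑ k ∈ Finset.range n, killedMass P y k x
          + ∑ k ∈ Finset.range m, killedMass P y (k + n) x := by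
          rw [Finset.sum_range_add]; simp only [add_comm n]
      _ ≤ n + ρ * ∑ k ∈ Finset.range m, killedMass P y k x := by
          refine add_le_add ?_ ?_
          · simpa using Finset.sum_le_sum
              fun k (_ : k ∈ Finset.range n) => killedMass_le_one h0 h1 y k x
          · rw [Finset.mul_sum]; exact Finset.sum_le_sum fun k _ => hstep k
  rw [le_div_iff₀ (by linarith)]
  linarith

lemma summable_killed_pow (h0 : ∀ x z, 0 ≤ P x z) (h1 : ∀ x, ∑ z, P x z = 1)
    (hirr : P.IsIrreducible) (y x z : X) : Summable fun k => (killed P y ^ k) x z :=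
  (summable_killedMass h0 h1 hirr y x).of_nonneg_of_le
    (fun _ => pow_nonneg_entry (killed_nonneg h0 y) _ _ _)
    fun k => Finset.single_le_sum (f := fun z => (killed P y ^ k) x z)
      (fun _ _ => pow_nonneg_entry (killed_nonneg h0 y) _ _ _) (Finset.mem_univ z)

lemma occupation_nonneg (h0 : ∀ x z, 0 ≤ P x z) (y x z : X) : 0 ≤ occupation P y x z :=
  tsum_nonneg fun _ => pow_nonneg_entry (killed_nonneg h0 y) _ _ _

lemma meanHit_nonneg (h0 : ∀ x z, 0 ≤ P x z) (y x : X) : 0 ≤ meanHit P y x :=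
  Finset.sum_nonneg fun _ _ => occupation_nonneg h0 _ _ _

/-- First-step analysis for the occupation measure. -/
lemma occupation_eq (h0 : ∀ x z, 0 ≤ P x z) (h1 : ∀ x, ∑ z, P x z = 1)
    (hirr : P.IsIrreducible) (y x z : X) :
    occupation P y x z = (if x = z then 1 else 0)
      + ∑ j, killed P y x j * occupation P y j z := by
  have hs := summable_killed_pow h0 h1 hirr y
  rw [occupation, (hs x z).tsum_eq_zero_add]
  congr 1
  simp only [pow_succ', Matrix.mul_apply]
  exact (hasSum_sum fun j _ => (hs j z).hasSum.mul_left (killed P y x j)).tsum_eq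

lemma meanHit_eq (h0 : ∀ x z, 0 ≤ P x z) (h1 : ∀ x, ∑ z, P x z = 1)
    (hirr : P.IsIrreducible) (y x : X) :
    meanHit P y x = 1 + ∑ j, killed P y x j * meanHit P y j := by
  simp only [meanHit, Finset.mul_sum]
  rw [Finset.sum_comm, Finset.sum_congr rfl fun z _ => occupation_eq h0 h1 hirr y x z,
    Finset.sum_add_distrib]
  simp

lemma one_le_meanHit (h0 : ∀ x z, 0 ≤ P x z) (h1 : ∀ x, ∑ z, P x z = 1)
    (hirr : P.IsIrreducible) (y x : X) : 1 ≤ meanHit P y x := by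
  rw [meanHit_eq h0 h1 hirr]
  have : 0 ≤ ∑ j, killed P y x j * meanHit P y j := Finset.sum_nonneg fun j _ =>
    mul_nonneg (killed_nonneg h0 _ _ _) (meanHit_nonneg h0 _ _)
  linarith

/-- The killed chain has no nonzero harmonic function. -/
lemma eq_zero_of_killed_harmonic (h0 : ∀ x z, 0 ≤ P x z) (h1 : ∀ x, ∑ z, P x z = 1)
    (hirr : P.IsIrreducible) (y : X) (F : X → ℝ)
    (hF : ∀ x, F x = ∑ j, killed P y x j * F j) (x : X) : F x = 0 := by
  have hH := one_le_meanHit h0 h1 hirr y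
  have hpos : ∀ x, 0 < meanHit P y x := fun x => one_pos.trans_le (hH x)
  -- Maximum principle with weight `meanHit`: at a maximizer of the ratio, harmonicity gives the
  -- same bound with the hitting time lowered by one, which forces the ratio to vanish.
  obtain ⟨x₀, -, hx₀⟩ := Finset.exists_max_image Finset.univ
    (fun x => |F x| / meanHit P y x) ⟨y, Finset.mem_univ y⟩
  set C := |F x₀| / meanHit P y x₀ with hC
  have hC0 : 0 ≤ C := div_nonneg (abs_nonneg _) (hpos _).le
  have hle : ∀ x, |F x| ≤ C * meanHit P y x := fun x =>
    (div_le_iff₀ (hpos x)).1 (hx₀ x (Finset.mem_univ _))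
  have heq : |F x₀| = C * meanHit P y x₀ := by rw [hC, div_mul_cancel₀ _ (hpos _).ne']
  have hup : |F x₀| ≤ C * (meanHit P y x₀ - 1) := by
    calc |F x₀| = |∑ j, killed P y x₀ j * F j| := by rw [← hF]
      _ ≤ ∑ j, |killed P y x₀ j * F j| := Finset.abs_sum_le_sum_abs _ _
      _ ≤ ∑ j, C * (killed P y x₀ j * meanHit P y j) := Finset.sum_le_sum fun j _ => by
          rw [abs_mul, abs_of_nonneg (killed_nonneg h0 _ _ _)]
          calc _ ≤ killed P y x₀ j * (C * meanHit P y j) :=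
                mul_le_mul_of_nonneg_left (hle j) (killed_nonneg h0 _ _ _)
            _ = _ := by ring
      _ = C * (meanHit P y x₀ - 1) := by
          rw [← Finset.mul_sum, meanHit_eq h0 h1 hirr y x₀]; ring
  have hCz : C = 0 := by nlinarith
  have := hle x
  rw [hCz, zero_mul] at this
  exact abs_nonpos_iff.1 this

lemma sum_killed_mul (y x : X) (F : X → ℝ) :
    ∑ j, killed P y x j * F j = ∑ j, P x j * F j - P x y * F y := by
  have h : ∀ j, killed P y x j * F j = P x j * F j - if j = y then P x y * F y else 0 := by
    intro j
    unfold killed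
    split_ifs with hj
    · subst hj; ring
    · ring
  simp [h, Finset.sum_sub_distrib]

/-- Kac's formula: the stationary mass of `z` is the reciprocal of its mean return time. -/
lemma stationary_mul_meanHit (h0 : ∀ x z, 0 ≤ P x z) (h1 : ∀ x, ∑ z, P x z = 1)
    (hirr : P.IsIrreducible) {d : X → ℝ} (hd1 : ∑ x, d x = 1)
    (hd : ∀ z, ∑ x, d x * P x z = d z) (z : X) : d z * meanHit P z z = 1 := by
  -- Average the first-step equation against `d`. Stationarity reproduces the same sum on the right,
  -- so the return-time term must balance the constant 1.
  have h : ∑ x, d x * meanHit P z x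
      = 1 + (∑ x, d x * meanHit P z x - d z * meanHit P z z) := by
    calc ∑ x, d x * meanHit P z x
        = ∑ x, (d x + (∑ j, d x * P x j * meanHit P z j - d x * P x z * meanHit P z z)) := by
          refine Finset.sum_congr rfl fun x _ => ?_
          conv_lhs => rw [meanHit_eq h0 h1 hirr, sum_killed_mul]
          simp only [mul_assoc, ← Finset.mul_sum]; ring
      _ = _ := by
          rw [Finset.sum_add_distrib, Finset.sum_sub_distrib, hd1, Finset.sum_comm]
          simp only [← Finset.sum_mul, hd]
  linarith

/-- The occupation measure in terms of mean hitting times. -/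
lemma occupation_formula (h0 : ∀ x z, 0 ≤ P x z) (h1 : ∀ x, ∑ z, P x z = 1)
    (hirr : P.IsIrreducible) {d : X → ℝ} (hd1 : ∑ x, d x = 1)
    (hd : ∀ z, ∑ x, d x * P x z = d z) (y x z : X) :
    occupation P y x z = d z * (meanHit P y x + (if y = z then 0 else meanHit P z y)
      - (if x = z then 0 else meanHit P z x)) := by
  -- The hitting time of `z`, set to zero at `z` itself. Then P u - u + 1 vanishes off `z` and
  -- equals the mean return time at `z`, so by Kac's formula `d z` times it is the point mass at
  -- `z`.
  set u : X → ℝ := fun x => if x = z then 0 else meanHit P z x with hu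
  have hPu : ∀ x, ∑ j, P x j * u j = meanHit P z x - 1 := by
    intro x
    rw [meanHit_eq h0 h1 hirr z x, add_sub_cancel_left]
    refine Finset.sum_congr rfl fun j _ => ?_
    simp only [hu, killed]; split_ifs <;> simp
  have hkac := stationary_mul_meanHit h0 h1 hirr hd1 hd z
  have hPuz : ∀ x, d z * (∑ j, P x j * u j - u x + 1) = if x = z then 1 else 0 := by
    intro x
    rw [hPu]
    by_cases hx : x = z
    · subst hx; simp only [hu, if_true]; linarith
    · simp only [hu, if_neg hx]; ring
  -- Both sides solve the same first-step equation, so their difference is harmonic for the killed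
  -- chain and therefore zero.
  have key := eq_zero_of_killed_harmonic h0 h1 hirr y
    (fun x => occupation P y x z - d z * (meanHit P y x + u y - u x)) ?_ x
  · simp only [sub_eq_zero] at key; exact key
  intro x
  have e1 := occupation_eq h0 h1 hirr y x z
  have e2 := meanHit_eq h0 h1 hirr y x
  -- The averaged function vanishes at `y`, so killing the transitions into `y` has no effect on it.
  have e3 : ∑ j, killed P y x j * (u y - u j) = u y - ∑ j, P x j * u j := by
    rw [sum_killed_mul, sub_self, mul_zero, sub_zero]
    simp only [mul_sub, Finset.sum_sub_distrib, ← Finset.sum_mul, h1, one_mul]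
  have e4 : ∑ j, killed P y x j * (occupation P y j z - d z * (meanHit P y j + u y - u j))
      = ∑ j, killed P y x j * occupation P y j z
        - d z * (∑ j, killed P y x j * meanHit P y j + ∑ j, killed P y x j * (u y - u j)) := by
    rw [← Finset.sum_add_distrib, Finset.mul_sum, ← Finset.sum_sub_distrib]
    exact Finset.sum_congr rfl fun j _ => by ring
  have e5 := hPuz x
  rw [e4, e3]
  linear_combination e1 - d z * e2 - e5

/-! ### Domination by the stationary law and Poisson's equation -/

section Bounds

variable {d : X → ℝ} {T : ℝ}

lemma stationary_pos (h0 : ∀ x z, 0 ≤ P x z) (h1 : ∀ x, ∑ z, P x z = 1)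
    (hirr : P.IsIrreducible) (hd1 : ∑ x, d x = 1) (hd : ∀ z, ∑ x, d x * P x z = d z) (z : X) :
    0 < d z :=
  pos_of_mul_pos_left (by rw [stationary_mul_meanHit h0 h1 hirr hd1 hd z]; exact one_pos)
    (meanHit_nonneg h0 z z)

lemma one_le_mul_stationary (h0 : ∀ x z, 0 ≤ P x z) (h1 : ∀ x, ∑ z, P x z = 1)
    (hirr : P.IsIrreducible) (hd1 : ∑ x, d x = 1) (hd : ∀ z, ∑ x, d x * P x z = d z)
    (hT : ∀ y x, meanHit P y x ≤ T) (z : X) : 1 ≤ T * d z := by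
  rw [← stationary_mul_meanHit h0 h1 hirr hd1 hd z, mul_comm]
  exact mul_le_mul_of_nonneg_right (hT z z) (stationary_pos h0 h1 hirr hd1 hd z).le

/-- In `occupation_formula` the subtracted hitting time is dropped, and each of the other two is at
most `T`. This density bound is what makes L²(d) estimates of excursion sums possible. -/
lemma occupation_le (h0 : ∀ x z, 0 ≤ P x z) (h1 : ∀ x, ∑ z, P x z = 1)
    (hirr : P.IsIrreducible) (hd1 : ∑ x, d x = 1) (hd : ∀ z, ∑ x, d x * P x z = d z)
    (hT : ∀ y x, meanHit P y x ≤ T) (y x z : X) : occupation P y x z ≤ 2 * T * d z := by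
  have hT0 : 0 ≤ T := (meanHit_nonneg h0 y x).trans (hT y x)
  rw [occupation_formula h0 h1 hirr hd1 hd, mul_comm]
  refine mul_le_mul_of_nonneg_right ?_ (stationary_pos h0 h1 hirr hd1 hd z).le
  have e1 : (if y = z then 0 else meanHit P z y) ≤ T := by split_ifs <;> simp [hT0, hT]
  have e2 : 0 ≤ (if x = z then 0 else meanHit P z x) := by
    split_ifs <;> simp [meanHit_nonneg h0]
  linarith [hT y x]

variable {E : Type*} [NormedAddCommGroup E]

/-- Poisson's equation. -/
lemma poisson_eq [NormedSpace ℝ E] (h0 : ∀ x z, 0 ≤ P x z) (h1 : ∀ x, ∑ z, P x z = 1)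
    (hirr : P.IsIrreducible) (hd1 : ∑ x, d x = 1) (hd : ∀ z, ∑ x, d x * P x z = d z)
    (f : X → E) (hf : ∑ z, d z • f z = 0) (y x : X) :
    ∑ z, occupation P y x z • f z
      = f x + ∑ j, P x j • ∑ z, occupation P y j z • f z := by
  -- An excursion from `y` back to `y` has occupation proportional to `d`, so a centred source sums
  -- to zero over it. The solution thus vanishes at `y`, and the killed transitions into `y` can be
  -- put back.
  have hy : ∑ z, occupation P y y z • f z = 0 := by
    have : ∀ z, occupation P y y z • f z = meanHit P y y • (d z • f z) := by
      intro z
      rw [occupation_formula h0 h1 hirr hd1 hd, smul_smul, add_sub_cancel_right, mul_comm]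
    simp only [this, ← Finset.smul_sum, hf, smul_zero]
  have hk : ∀ j, P x j • ∑ z, occupation P y j z • f z
      = killed P y x j • ∑ z, occupation P y j z • f z := by
    intro j
    unfold killed
    split_ifs with hj
    · subst hj; rw [hy, smul_zero, zero_smul]
    · rfl
  simp only [hk]
  simp only [Finset.smul_sum, smul_smul]
  rw [Finset.sum_comm]
  simp only [← Finset.sum_smul]
  conv_lhs => enter [2, z]; rw [occupation_eq h0 h1 hirr, add_smul]
  rw [Finset.sum_add_distrib]
  simp

lemma sq_norm_sum_smul_le [NormedSpace ℝ E] {ι : Type*} [Fintype ι] (w : ι → ℝ)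
    (hw : ∀ i, 0 ≤ w i) (f : ι → E) :
    ‖∑ i, w i • f i‖ ^ 2 ≤ (∑ i, w i) * ∑ i, w i * ‖f i‖ ^ 2 := by
  have h1 : ‖∑ i, w i • f i‖ ≤ ∑ i, w i * ‖f i‖ := (norm_sum_le _ _).trans_eq
    (Finset.sum_congr rfl fun i _ => by rw [norm_smul, Real.norm_of_nonneg (hw i)])
  refine (pow_le_pow_left₀ (norm_nonneg _) h1 2).trans ?_
  exact Finset.sum_sq_le_sum_mul_sum_of_sq_le_mul _ (fun i _ => hw i)
    (fun i _ => mul_nonneg (hw i) (sq_nonneg _)) fun i _ => le_of_eq (by ring)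

/-- Cauchy–Schwarz with the occupation weights: their total mass is a mean hitting time, at most
`T`, and their density against `d` is at most `2 * T`. -/
lemma sq_norm_occupation_sum_le [NormedSpace ℝ E] (h0 : ∀ x z, 0 ≤ P x z)
    (h1 : ∀ x, ∑ z, P x z = 1) (hirr : P.IsIrreducible) (hd1 : ∑ x, d x = 1)
    (hd : ∀ z, ∑ x, d x * P x z = d z) (hT : ∀ y x, meanHit P y x ≤ T) (f : X → E) (y x : X) :
    ‖∑ z, occupation P y x z • f z‖ ^ 2 ≤ 2 * T ^ 2 * ∑ z, d z * ‖f z‖ ^ 2 := by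
  have hT0 : 0 ≤ T := (meanHit_nonneg h0 y x).trans (hT y x)
  refine (sq_norm_sum_smul_le _ (fun z => occupation_nonneg h0 y x z) f).trans ?_
  calc (∑ z, occupation P y x z) * ∑ z, occupation P y x z * ‖f z‖ ^ 2
      ≤ T * ∑ z, 2 * T * d z * ‖f z‖ ^ 2 := by
        refine mul_le_mul (hT y x) (Finset.sum_le_sum fun z _ => mul_le_mul_of_nonneg_right
          (occupation_le h0 h1 hirr hd1 hd hT y x z) (sq_nonneg _))
          (Finset.sum_nonneg fun z _ => mul_nonneg (occupation_nonneg h0 _ _ _) (sq_nonneg _)) hT0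
    _ = _ := by simp only [mul_assoc, ← Finset.mul_sum]; ring

/-- The solution of Poisson's equation is bounded by the `L²(d)` norm of the uncentred source. -/
lemma sq_norm_occupation_sum_centred_le [InnerProductSpace ℝ E] (h0 : ∀ x z, 0 ≤ P x z)
    (h1 : ∀ x, ∑ z, P x z = 1) (hirr : P.IsIrreducible) (hd1 : ∑ x, d x = 1)
    (hd : ∀ z, ∑ x, d x * P x z = d z) (hT : ∀ y x, meanHit P y x ≤ T) (f : X → E) (y x : X) :
    ‖∑ z, occupation P y x z • (f z - ∑ j, d j • f j)‖ ^ 2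
      ≤ 2 * T ^ 2 * ∑ z, d z * ‖f z‖ ^ 2 := by
  refine (sq_norm_occupation_sum_le h0 h1 hirr hd1 hd hT _ y x).trans ?_
  refine mul_le_mul_of_nonneg_left ?_ (by positivity)
  set c := ∑ j, d j • f j with hc
  -- The variance is the second moment minus the squared norm of the mean, so centring only lowers
  -- the bound.
  have : ∑ z, d z * ‖f z - c‖ ^ 2 = ∑ z, d z * ‖f z‖ ^ 2 - ‖c‖ ^ 2 := by
    have e : ∀ z, d z * ‖f z - c‖ ^ 2
        = d z * ‖f z‖ ^ 2 - 2 * inner ℝ (d z • f z) c + d z * ‖c‖ ^ 2 := by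
      intro z
      rw [norm_sub_sq_real, inner_smul_left]; simp; ring
    simp only [e]
    rw [Finset.sum_add_distrib, Finset.sum_sub_distrib, ← Finset.mul_sum, ← sum_inner, ← hc,
      ← Finset.sum_mul, hd1, real_inner_self_eq_norm_sq]
    ring
  rw [this]
  linarith [sq_nonneg ‖c‖]

end Bounds

end Killed

/-! ### The state-action chain: transition matrix, path law and hitting times -/

namespace Model

variable {S A : Type*} {h : ℕ} (M : Model S A h)

lemma stepMatrix_nonneg (x z : S × A) : 0 ≤ M.stepMatrix x z := ENNReal.toReal_nonneg

lemma sum_toReal_pmf {X : Type*} [Fintype X] (p : PMF X) : ∑ x, (p x).toReal = 1 := by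
  rw [← ENNReal.toReal_sum fun x _ => p.apply_ne_top x, ← tsum_fintype (L := .unconditional _),
    p.tsum_coe, ENNReal.toReal_one]

lemma sum_stepMatrix [Fintype S] [Fintype A] (x : S × A) : ∑ z, M.stepMatrix x z = 1 :=
  sum_toReal_pmf _

lemma stationary_sum [Fintype S] [Fintype A] {d : PMF (S × A)} (hd : M.IsStationary d)
    (z : S × A) : ∑ x, (d x).toReal * M.stepMatrix x z = (d z).toReal := by
  conv_rhs => rw [← hd, PMF.bind_apply, tsum_fintype]
  rw [ENNReal.toReal_sum fun x _ => ENNReal.mul_ne_top (d.apply_ne_top x)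
    ((M.step x).apply_ne_top z)]
  simp [stepMatrix]

/-- Averaging a function of the next state only. -/
lemma sum_stepMatrix_fst [Fintype S] [Fintype A] {E : Type*} [NormedAddCommGroup E]
    [NormedSpace ℝ E] (x : S × A) (f : S → E) :
    ∑ z : S × A, M.stepMatrix x z • f z.1 = ∑ s', (M.trans x.1 x.2 s').toReal • f s' := by
  classical
  rw [Fintype.sum_prod_type]
  refine Finset.sum_congr rfl fun s' _ => ?_
  simp only
  rw [← Finset.sum_smul]
  congr 1
  have h : ∀ a, M.stepMatrix x (s', a)
      = (M.trans x.1 x.2 s').toReal * (M.behav s' a).toReal := by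
    intro a
    rw [stepMatrix, step, PMF.bind_apply, tsum_eq_single s', ENNReal.toReal_mul]
    · congr 2
      rw [PMF.map_apply, tsum_eq_single a]
      · simp
      · intro b hb
        simp [hb.symm]
    · intro b hb
      rw [PMF.map_apply, ENNReal.tsum_eq_zero.2, mul_zero]
      intro c
      simp [hb.symm]
  simp only [h, ← Finset.mul_sum, sum_toReal_pmf, mul_one]

section Path

variable [Fintype S] [Fintype A]
  [MeasurableSpace S] [DiscreteMeasurableSpace S] [MeasurableSpace A] [DiscreteMeasurableSpace A]

instance (x : S × A) : IsProbabilityMeasure (M.pathLaw x) := by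
  unfold pathLaw; infer_instance

lemma pathLaw_zero (x : S × A) : ∀ᵐ w ∂M.pathLaw x, w 0 = x := by
  have h := Kernel.traj_map_frestrictLe_apply (X := fun _ => S × A) (κ := M.historyKernel) 0 0
    (fun _ => x)
  rw [Kernel.partialTraj_self, Kernel.id_apply] at h
  have hae : ∀ᵐ v ∂(M.pathLaw x).map (Preorder.frestrictLe (π := fun _ => S × A) 0),
      v ⟨0, Finset.mem_Iic.2 le_rfl⟩ = x := by
    rw [pathLaw, h, ae_dirac_iff]
    exact measurableSet_eq_fun (measurable_pi_apply _) measurable_const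
  exact ae_of_ae_map (by fun_prop) hae

/-- The Markov property of the path law at time `k`. -/
lemma pathLaw_succ (x j z : S × A) (k : ℕ) (B : Set (Π _ : Finset.Iic k, S × A))
    (hB : ∀ v ∈ B, v ⟨k, Finset.mem_Iic.2 le_rfl⟩ = j) :
    (M.pathLaw x).real {w | Preorder.frestrictLe (π := fun _ => S × A) k w ∈ B ∧ w (k + 1) = z}
      = (M.pathLaw x).real {w | Preorder.frestrictLe (π := fun _ => S × A) k w ∈ B}
        * M.stepMatrix j z := by
  have hBm : MeasurableSet B := (Set.toFinite B).measurableSet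
  have h := Kernel.partialTraj_compProd_eq_map_traj (X := fun _ => S × A) (κ := M.historyKernel)
    (Nat.zero_le k) (x₀ := fun _ => x)
  have h2 := congrArg (fun μ => μ (B ×ˢ {z})) h
  beta_reduce at h2
  rw [Measure.compProd_apply_prod hBm (measurableSet_singleton z),
    ← Kernel.traj_map_frestrictLe_apply,
    setLIntegral_congr_fun (g := fun _ => M.step j z) hBm, setLIntegral_const,
    Measure.map_apply (by fun_prop) hBm,
    Measure.map_apply (by fun_prop) (hBm.prod (measurableSet_singleton z))] at h2
  · have h3 := congrArg ENNReal.toReal h2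
    rw [ENNReal.toReal_mul, mul_comm] at h3
    exact h3.symm
  · intro v hv
    simp only [historyKernel, Kernel.comap_apply, hB v hv]
    exact PMF.toMeasure_apply_singleton _ _ (measurableSet_singleton z)

/-- Trajectories which are at `z` at time `k` and avoid `y` at times `1, …, k`. -/
def avoid (y : S × A) (k : ℕ) (z : S × A) : Set (ℕ → S × A) :=
  {w | (∀ i, 1 ≤ i → i ≤ k → w i ≠ y) ∧ w k = z}

omit [Fintype S] [Fintype A] in
lemma measurableSet_avoid [Finite S] [Finite A] (y : S × A) (k : ℕ) (z : S × A) :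
    MeasurableSet (avoid y k z) := by
  have : avoid y k z = (⋂ i ∈ Set.Icc 1 k, (fun w : ℕ → S × A => w i) ⁻¹' {y}ᶜ)
      ∩ (fun w : ℕ → S × A => w k) ⁻¹' {z} := by
    ext w; simp [avoid]
  rw [this]
  refine (MeasurableSet.biInter (Set.to_countable _) fun i _ => ?_).inter ?_
  · exact measurable_pi_apply i (measurableSet_singleton y).compl
  · exact measurable_pi_apply k (measurableSet_singleton z)

-- The bridge from the trajectory measure to matrix algebra: by the Markov property, avoiding `y`
-- for one more step is one more multiplication by the killed matrix.
open scoped Classical in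
lemma pathLaw_avoid (x y : S × A) (k : ℕ) (z : S × A) :
    (M.pathLaw x).real (avoid y k z) = (killed M.stepMatrix y ^ k) x z := by
  induction k generalizing z with
  | zero =>
    have h0 := M.pathLaw_zero x
    rw [pow_zero, Matrix.one_apply]
    split_ifs with hxz
    · rw [← probReal_univ (μ := M.pathLaw x)]
      refine measureReal_congr ?_
      filter_upwards [h0] with w hw
      refine propext ⟨fun _ => trivial, fun _ => ⟨fun i h1 h2 => by omega, by rw [hw, hxz]⟩⟩
    · rw [← measureReal_empty (μ := M.pathLaw x)]
      refine measureReal_congr ?_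
      filter_upwards [h0] with w hw
      refine propext ⟨fun hw2 => hxz (hw ▸ hw2.2), fun hw2 => hw2.elim⟩
  | succ k ih =>
    rw [pow_succ, Matrix.mul_apply]
    by_cases hz : z = y
    · have : avoid y (k + 1) z = ∅ := by
        ext w
        simp only [avoid, Set.mem_ofPred_eq, Set.mem_empty_iff_false, iff_false, not_and]
        intro hw hw2
        exact hw (k + 1) (by omega) le_rfl (hw2.trans hz)
      rw [this, measureReal_empty]
      simp [killed, hz]
    · have hun : avoid y (k + 1) z = ⋃ j : S × A, (avoid y k j ∩ {w | w (k + 1) = z}) := by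
        ext w
        simp only [avoid, Set.mem_ofPred_eq, Set.mem_iUnion, Set.mem_inter_iff]
        constructor
        · rintro ⟨h1, h2⟩
          exact ⟨w k, ⟨fun i hi hik => h1 i hi (by omega), rfl⟩, h2⟩
        · rintro ⟨j, ⟨h1, h2⟩, h3⟩
          refine ⟨fun i hi hik => ?_, h3⟩
          rcases Nat.lt_or_ge i (k + 1) with hlt | hge
          · exact h1 i hi (by omega)
          · have : i = k + 1 := by omega
            rw [this, h3]; exact hz
      have hmz : MeasurableSet {w : ℕ → S × A | w (k + 1) = z} :=
        (measurableSet_singleton z).preimage (measurable_pi_apply (k + 1))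
      rw [hun, measureReal_iUnion_fintype]
      · refine Finset.sum_congr rfl fun j _ => ?_
        have hs := M.pathLaw_succ x j z k
          {v | (∀ i (hi : i ∈ Finset.Iic k), 1 ≤ i → v ⟨i, hi⟩ ≠ y)
            ∧ v ⟨k, Finset.mem_Iic.2 le_rfl⟩ = j} (fun v hv => hv.2)
        -- The avoidance event depends only on the history up to time `k`, which is the form that
        -- `pathLaw_succ` requires.
        have e : {w : ℕ → S × A | Preorder.frestrictLe (π := fun _ => S × A) k w ∈
            {v : Π _ : Finset.Iic k, S × A | (∀ i (hi : i ∈ Finset.Iic k), 1 ≤ i → v ⟨i, hi⟩ ≠ y)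
              ∧ v ⟨k, Finset.mem_Iic.2 le_rfl⟩ = j}} = avoid y k j := by
          ext w
          simp only [avoid, Set.mem_ofPred_eq, Finset.mem_Iic, Preorder.frestrictLe_apply]
          exact and_congr_left fun _ => ⟨fun h i h1 h2 => h i h2 h1, fun h i h1 h2 => h i h2 h1⟩
        rw [e, ih j] at hs
        have e2 : killed M.stepMatrix y j z = M.stepMatrix j z := by simp [killed, hz]
        rw [e2, ← hs]
        congr 1
        ext w
        constructor
        · intro hw; exact ⟨(Set.ext_iff.1 e w).2 hw.1, hw.2⟩
        · intro hw; exact ⟨(Set.ext_iff.1 e w).1 hw.1, hw.2⟩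
      · intro i j hij
        refine Set.disjoint_left.2 fun w hw hw2 => hij ?_
        rw [← hw.1.2, ← hw2.1.2]
      · exact fun j => (measurableSet_avoid y k j).inter hmz

-- The hypothesis that `y` is hit is essential: otherwise the infimum is over the empty set and
-- `hitTime` takes the default value 0.
omit [Fintype S] [Fintype A] [MeasurableSpace S] [DiscreteMeasurableSpace S] [MeasurableSpace A]
  [DiscreteMeasurableSpace A] in
lemma lt_hitTime_iff {y : S × A} {w : ℕ → S × A} (hw : ∃ n, 1 ≤ n ∧ w n = y) (k : ℕ) :
    k < hitTime y w ↔ ∀ i, 1 ≤ i → i ≤ k → w i ≠ y := by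
  constructor
  · intro hk i h1 h2 hi
    have hle : hitTime y w ≤ i := Nat.sInf_le ⟨h1, hi⟩
    omega
  · intro hall
    by_contra hk
    have hmem : hitTime y w ∈ {n | 1 ≤ n ∧ w n = y} := Nat.sInf_mem hw
    exact hall _ hmem.1 (by omega) hmem.2

/-- A trajectory that never hits `y` avoids it up to every time `k`. The probability of that is the
killed mass, which is summable in `k` and so tends to zero. -/
lemma ae_exists_hit (hirr : M.stepMatrix.IsIrreducible) (x y : S × A) :
    ∀ᵐ w ∂M.pathLaw x, ∃ n, 1 ≤ n ∧ w n = y := by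
  classical
  rw [ae_iff]
  have hle : ∀ k, (M.pathLaw x).real {w | ¬∃ n, 1 ≤ n ∧ w n = y}
      ≤ killedMass M.stepMatrix y k x := by
    intro k
    calc (M.pathLaw x).real {w | ¬∃ n, 1 ≤ n ∧ w n = y}
        ≤ (M.pathLaw x).real (⋃ z, avoid y k z) := by
          refine measureReal_mono ?_
          intro w hw
          simp only [Set.mem_ofPred_eq, not_exists, not_and] at hw
          exact Set.mem_iUnion.2 ⟨w k, fun i h1 _ => hw i h1, rfl⟩
      _ ≤ ∑ z, (M.pathLaw x).real (avoid y k z) := measureReal_iUnion_fintype_le _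
      _ = _ := by simp only [pathLaw_avoid, killedMass]
  have hlim := (summable_killedMass M.stepMatrix_nonneg M.sum_stepMatrix hirr y
    x).tendsto_atTop_zero
  have h0 : (M.pathLaw x).real {w | ¬∃ n, 1 ≤ n ∧ w n = y} ≤ 0 :=
    ge_of_tendsto' hlim hle
  have h1 := le_antisymm h0 measureReal_nonneg
  rwa [measureReal_eq_zero_iff] at h1

open scoped Classical in
/-- Expected sums along an excursion in terms of the occupation measure. -/
lemma integral_sum_hitTime (hirr : M.stepMatrix.IsIrreducible) {E : Type*}
    [NormedAddCommGroup E] [NormedSpace ℝ E] [CompleteSpace E] (f : S × A → E) (x y : S × A) :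
    ∫ w, ∑ k ∈ Finset.range (hitTime y w), f (w k) ∂M.pathLaw x
      = ∑ z, occupation M.stepMatrix y x z • f z := by
  have hs := summable_killed_pow M.stepMatrix_nonneg M.sum_stepMatrix hirr y x
  -- The `k`-th term of the excursion sum, cut off at the hitting time and split by the position at
  -- time `k`. Each piece integrates to an entry of a power of the killed matrix, and summability of
  -- these entries justifies exchanging sum and integral.
  set F : ℕ → (ℕ → S × A) → E := fun k w =>
    ∑ z, (avoid y k z).indicator (fun _ => (1 : ℝ)) w • f z with hF
  have hint1 : ∀ k z, Integrable ((avoid y k z).indicator fun _ => (1 : ℝ)) (M.pathLaw x) :=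
    fun k z => (integrable_const _).indicator (measurableSet_avoid y k z)
  have hval1 : ∀ k z, ∫ w, (avoid y k z).indicator (fun _ => (1 : ℝ)) w ∂M.pathLaw x
      = (killed M.stepMatrix y ^ k) x z := by
    intro k z
    rw [integral_indicator_const _ (measurableSet_avoid y k z), pathLaw_avoid, smul_eq_mul,
      mul_one]
  have hFint : ∀ k, Integrable (F k) (M.pathLaw x) := fun k =>
    integrable_finsetSum _ fun z _ => (hint1 k z).smul_const (f z)
  have hFval : ∀ k, ∫ w, F k w ∂M.pathLaw x = ∑ z, (killed M.stepMatrix y ^ k) x z • f z := by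
    intro k
    rw [hF, integral_finsetSum _ fun z _ => (hint1 k z).smul_const (f z)]
    exact Finset.sum_congr rfl fun z _ => by rw [integral_smul_const, hval1]
  have hFnorm : Summable fun k => ∫ w, ‖F k w‖ ∂M.pathLaw x := by
    refine Summable.of_nonneg_of_le (fun k => integral_nonneg fun _ => norm_nonneg _)
      (fun k => ?_) (summable_sum fun z (_ : z ∈ Finset.univ) => (hs z).mul_right ‖f z‖)
    calc ∫ w, ‖F k w‖ ∂M.pathLaw x
        ≤ ∫ w, ∑ z, (avoid y k z).indicator (fun _ => (1 : ℝ)) w * ‖f z‖ ∂M.pathLaw x := by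
          refine integral_mono (hFint k).norm
            (integrable_finsetSum _ fun z _ => (hint1 k z).mul_const _) fun w => ?_
          refine (norm_sum_le _ _).trans (Finset.sum_le_sum fun z _ => ?_)
          rw [norm_smul, Real.norm_of_nonneg (Set.indicator_nonneg (fun _ _ => zero_le_one) _)]
      _ = ∑ z, (killed M.stepMatrix y ^ k) x z * ‖f z‖ := by
          rw [integral_finsetSum _ fun z _ => (hint1 k z).mul_const _]
          simp only [integral_mul_const, hval1]
  have hsum := hasSum_integral_of_summable_integral_norm hFint hFnorm
  simp only [hFval] at hsum
  have hocc : HasSum (fun k => ∑ z, (killed M.stepMatrix y ^ k) x z • f z)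
      (∑ z, occupation M.stepMatrix y x z • f z) :=
    hasSum_sum fun z _ => (hs z).hasSum.smul_const (f z)
  rw [← hsum.unique hocc]
  refine integral_congr_ae ?_
  filter_upwards [M.ae_exists_hit hirr x y] with w hw
  have hFw : ∀ k, F k w = if k < hitTime y w then f (w k) else 0 := by
    intro k
    rw [hF]
    simp only
    rw [Finset.sum_eq_single (w k)]
    · by_cases hk : k < hitTime y w
      · rw [if_pos hk, Set.indicator_of_mem, one_smul]
        exact ⟨(lt_hitTime_iff hw k).1 hk, rfl⟩
      · rw [if_neg hk, Set.indicator_of_notMem, zero_smul]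
        exact fun hmem => hk ((lt_hitTime_iff hw k).2 hmem.1)
    · intro z _ hz
      rw [Set.indicator_of_notMem, zero_smul]
      exact fun hmem => hz hmem.2.symm
    · exact fun hn => absurd (Finset.mem_univ _) hn
  simp only [hFw]
  rw [tsum_eq_sum (s := Finset.range (hitTime y w))]
  · exact Finset.sum_congr rfl fun k hk => by rw [if_pos (Finset.mem_range.1 hk)]
  · intro k hk
    rw [if_neg (by simpa using hk)]

-- With the constant source 1, the excursion sum is the hitting time itself, so the matrix quantity
-- `meanHit` is the integral that appears in `tauMax`.
open scoped Classical in
lemma meanHit_le_tauMax (hirr : M.stepMatrix.IsIrreducible) (y x : S × A) :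
    meanHit M.stepMatrix y x ≤ M.tauMax := by
  have h := M.integral_sum_hitTime hirr (fun _ => (1 : ℝ)) x y
  simp only [Finset.sum_const, Finset.card_range, nsmul_eq_mul, mul_one, smul_eq_mul] at h
  rw [meanHit, ← h]
  exact le_ciSup (f := fun p : (S × A) × (S × A) => ∫ w, (hitTime p.2 w : ℝ) ∂M.pathLaw p.1)
    (Set.finite_range _).bddAbove (x, y)

end Path

end Model

/-! ### Quadratic forms and extreme eigenvalues -/

section Rayleigh

variable {n : Type*} [Fintype n] [DecidableEq n] {B : Matrix n n ℝ}

lemma rayleigh_eq (hB : B.IsHermitian) (v : EuclideanSpace ℝ n) :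
    v.ofLp ⬝ᵥ (B *ᵥ v.ofLp)
      = ∑ i, hB.eigenvalues i * inner ℝ (hB.eigenvectorBasis i) v ^ 2 := by
  have h1 : v.ofLp ⬝ᵥ (B *ᵥ v.ofLp) = inner ℝ v (Matrix.toEuclideanLin B v) := by
    rw [PiLp.inner_apply]
    simp [dotProduct, mul_comm, Matrix.toLpLin_apply]
  rw [h1, ← hB.eigenvectorBasis.sum_inner_mul_inner]
  refine Finset.sum_congr rfl fun i _ => ?_
  have h2 : inner ℝ (hB.eigenvectorBasis i) (Matrix.toEuclideanLin B v)
      = hB.eigenvalues i * inner ℝ (hB.eigenvectorBasis i) v := by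
    have hsymm := Matrix.isSymmetric_toEuclideanLin_iff.2 hB
    rw [← hsymm]
    have h3 : Matrix.toEuclideanLin B (hB.eigenvectorBasis i)
        = hB.eigenvalues i • hB.eigenvectorBasis i := by
      ext j
      simpa [Matrix.toLpLin_apply] using congrFun (hB.mulVec_eigenvectorBasis i) j
    rw [h3, inner_smul_left]; simp
  rw [h2, real_inner_comm v]; ring

lemma sInf_spectrum_mul_le (hB : B.IsHermitian) (v : EuclideanSpace ℝ n) :
    sInf (spectrum ℝ B) * ‖v‖ ^ 2 ≤ v.ofLp ⬝ᵥ (B *ᵥ v.ofLp) := by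
  rw [rayleigh_eq hB, ← hB.eigenvectorBasis.sum_sq_inner_right v, Finset.mul_sum]
  exact Finset.sum_le_sum fun i _ => mul_le_mul_of_nonneg_right
    (csInf_le B.finite_real_spectrum.bddBelow (hB.eigenvalues_mem_spectrum_real i)) (sq_nonneg _)

lemma le_sSup_spectrum_mul (hB : B.IsHermitian) (v : EuclideanSpace ℝ n) :
    v.ofLp ⬝ᵥ (B *ᵥ v.ofLp) ≤ sSup (spectrum ℝ B) * ‖v‖ ^ 2 := by
  rw [rayleigh_eq hB, ← hB.eigenvectorBasis.sum_sq_inner_right v, Finset.mul_sum]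
  exact Finset.sum_le_sum fun i _ => mul_le_mul_of_nonneg_right
    (le_csSup B.finite_real_spectrum.bddAbove (hB.eigenvalues_mem_spectrum_real i)) (sq_nonneg _)

lemma sInf_spectrum_nonneg (hB : B.PosSemidef) : 0 ≤ sInf (spectrum ℝ B) := by
  refine Real.sInf_nonneg fun r hr => ?_
  rw [hB.isHermitian.spectrum_real_eq_range_eigenvalues] at hr
  obtain ⟨i, rfl⟩ := hr
  exact hB.eigenvalues_nonneg i

/-- This needs no nonemptiness: over an empty spectrum both sides take the default value 0. -/
lemma sInf_spectrum_le_sSup : sInf (spectrum ℝ B) ≤ sSup (spectrum ℝ B) :=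
  Real.sInf_le_sSup _ B.finite_real_spectrum.bddBelow B.finite_real_spectrum.bddAbove

end Rayleigh

/-! ### The regularized Gram operator N = ΦᵀDΦ + ηI -/

namespace Model

variable {S A : Type*} {h : ℕ} (M : Model S A h)

lemma lin_add (v w : EuclideanSpace ℝ (Fin h)) : M.lin (v + w) = M.lin v + M.lin w := by
  funext x; simp [lin, inner_add_right]

lemma lin_sub (v w : EuclideanSpace ℝ (Fin h)) : M.lin (v - w) = M.lin v - M.lin w := by
  funext x; simp [lin, inner_sub_right]

lemma lin_smul (c : ℝ) (v : EuclideanSpace ℝ (Fin h)) : M.lin (c • v) = c • M.lin v := by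
  funext x; simp [lin, inner_smul_right]

lemma abs_lin_le (hfeat : ∀ s a, ‖M.feat s a‖ ≤ 1) (v : EuclideanSpace ℝ (Fin h)) (x : S × A) :
    |M.lin v x| ≤ ‖v‖ :=
  (abs_real_inner_le_norm _ _).trans (mul_le_of_le_one_left (norm_nonneg _) (hfeat _ _))

lemma featMatrix_mulVec (v : EuclideanSpace ℝ (Fin h)) :
    M.featMatrix *ᵥ v.ofLp = M.lin v := by
  funext x
  simp [lin, featMatrix, Matrix.mulVec, dotProduct, PiLp.inner_apply, mul_comm]

section

variable [Fintype S] [Fintype A] (d : PMF (S × A))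

/-- The operator `Φᵀ D Φ + η I`. -/
def reg (v : EuclideanSpace ℝ (Fin h)) : EuclideanSpace ℝ (Fin h) :=
  ∑ x, (d x).toReal • (M.lin v x • M.feat x.1 x.2) + M.η • v

/-- The vector `Φᵀ D u`. -/
def proj (u : S × A → ℝ) : EuclideanSpace ℝ (Fin h) :=
  ∑ x, (d x).toReal • (u x • M.feat x.1 x.2)

lemma inner_proj (u : S × A → ℝ) (w : EuclideanSpace ℝ (Fin h)) :
    inner ℝ (M.proj d u) w = ∑ x, (d x).toReal * (u x * M.lin w x) := by
  simp [proj, sum_inner, inner_smul_left, lin]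

lemma inner_reg (v w : EuclideanSpace ℝ (Fin h)) :
    inner ℝ (M.reg d v) w
      = ∑ x, (d x).toReal * (M.lin v x * M.lin w x) + M.η * inner ℝ v w := by
  simp [reg, inner_add_left, sum_inner, inner_smul_left, lin]

lemma inner_reg_comm (v w : EuclideanSpace ℝ (Fin h)) :
    inner ℝ (M.reg d v) w = inner ℝ v (M.reg d w) := by
  rw [real_inner_comm (M.reg d w) v, inner_reg, inner_reg, real_inner_comm v w]
  simp only [mul_comm (M.lin v _)]

lemma reg_add (v w : EuclideanSpace ℝ (Fin h)) : M.reg d (v + w) = M.reg d v + M.reg d w := by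
  simp only [reg, lin_add, Pi.add_apply, add_smul, smul_add, Finset.sum_add_distrib]
  abel

lemma reg_smul (c : ℝ) (v : EuclideanSpace ℝ (Fin h)) : M.reg d (c • v) = c • M.reg d v := by
  simp only [reg, lin_smul, Pi.smul_apply, smul_eq_mul, smul_add, Finset.smul_sum]
  congr 1
  · refine Finset.sum_congr rfl fun x _ => ?_
    simp only [smul_smul]; congr 1; ring
  · rw [smul_comm]

lemma reg_sub (v w : EuclideanSpace ℝ (Fin h)) : M.reg d (v - w) = M.reg d v - M.reg d w := by
  rw [sub_eq_add_neg, reg_add, ← neg_one_smul ℝ w, reg_smul, neg_one_smul, sub_eq_add_neg]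

lemma featD_mulVec (u : S × A → ℝ) : M.featD d *ᵥ u = (M.proj d u).ofLp := by
  classical
  funext i
  simp only [featD, ← Matrix.mulVec_mulVec]
  simp [Matrix.mulVec, dotProduct, proj, featMatrix, Matrix.diagonal_apply]
  exact Finset.sum_congr rfl fun x _ => by ring

lemma gram_mulVec (v : EuclideanSpace ℝ (Fin h)) :
    M.gram d *ᵥ v.ofLp = (M.proj d (M.lin v)).ofLp := by
  rw [gram, ← Matrix.mulVec_mulVec, featMatrix_mulVec, featD_mulVec]

lemma reg_ofLp (v : EuclideanSpace ℝ (Fin h)) :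
    (M.reg d v).ofLp = (M.gram d + M.η • (1 : Matrix (Fin h) (Fin h) ℝ)) *ᵥ v.ofLp := by
  rw [Matrix.add_mulVec, gram_mulVec, Matrix.smul_mulVec, Matrix.one_mulVec]
  simp [reg, proj]

lemma gram_posSemidef : (M.gram d).PosSemidef := by
  classical
  have h1 : (Matrix.diagonal fun x => (d x).toReal).PosSemidef :=
    Matrix.PosSemidef.diagonal fun _ => ENNReal.toReal_nonneg
  have h2 := h1.conjTranspose_mul_mul_same M.featMatrix
  rw [Matrix.conjTranspose_eq_transpose_of_trivial] at h2
  unfold gram featD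
  convert h2

lemma gram_quadratic (v : EuclideanSpace ℝ (Fin h)) :
    v.ofLp ⬝ᵥ (M.gram d *ᵥ v.ofLp) = ∑ x, (d x).toReal * M.lin v x ^ 2 := by
  have h1 : v.ofLp ⬝ᵥ (M.gram d *ᵥ v.ofLp) = inner ℝ (M.proj d (M.lin v)) v := by
    rw [gram_mulVec, PiLp.inner_apply]
    simp [dotProduct]
  rw [h1, inner_proj]
  exact Finset.sum_congr rfl fun x _ => by ring

lemma mu_mul_le (v : EuclideanSpace ℝ (Fin h)) :
    M.mu d * ‖v‖ ^ 2 ≤ inner ℝ (M.reg d v) v := by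
  have h1 := sInf_spectrum_mul_le (M.gram_posSemidef d).isHermitian v
  rw [gram_quadratic] at h1
  rw [inner_reg, real_inner_self_eq_norm_sq, mu, add_mul]
  simp only [← pow_two]
  linarith

lemma le_ell_mul (v : EuclideanSpace ℝ (Fin h)) :
    inner ℝ (M.reg d v) v ≤ M.ell d * ‖v‖ ^ 2 := by
  have h1 := le_sSup_spectrum_mul (M.gram_posSemidef d).isHermitian v
  rw [gram_quadratic] at h1
  rw [inner_reg, real_inner_self_eq_norm_sq, ell, add_mul]
  simp only [← pow_two]
  linarith

lemma eta_le_mu : M.η ≤ M.mu d := by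
  have := sInf_spectrum_nonneg (M.gram_posSemidef d)
  unfold mu; linarith

lemma mu_le_ell : M.mu d ≤ M.ell d := by
  unfold mu ell
  have := sInf_spectrum_le_sSup (B := M.gram d)
  linarith

lemma inner_reg_self_nonneg (hη : 0 < M.η) (v : EuclideanSpace ℝ (Fin h)) :
    0 ≤ inner ℝ (M.reg d v) v :=
  (mul_nonneg (hη.le.trans (M.eta_le_mu d)) (sq_nonneg _)).trans (M.mu_mul_le d v)

/-- `‖N v‖² ≥ μ ⟨N v, v⟩`. -/
lemma mu_mul_inner_le (hη : 0 < M.η) (v : EuclideanSpace ℝ (Fin h)) :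
    M.mu d * inner ℝ (M.reg d v) v ≤ ‖M.reg d v‖ ^ 2 := by
  have hμ : 0 < M.mu d := hη.trans_le (M.eta_le_mu d)
  have h1 := M.mu_mul_le d v
  have h2 := real_inner_le_norm (M.reg d v) v
  have h0 := M.inner_reg_self_nonneg d hη v
  rcases (norm_nonneg v).eq_or_lt with hv | hv
  · rw [← hv, mul_zero] at h2
    nlinarith [sq_nonneg ‖M.reg d v‖]
  · have h3 : M.mu d * ‖v‖ ≤ ‖M.reg d v‖ := by
      by_contra hc
      nlinarith
    nlinarith [norm_nonneg (M.reg d v)]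

/-- Cauchy–Schwarz for the energy form: the form is nonnegative at v + t w for all t, so the
discriminant in t is nonpositive. -/
lemma sq_inner_reg_le (hη : 0 < M.η) (v w : EuclideanSpace ℝ (Fin h)) :
    inner ℝ (M.reg d v) w ^ 2 ≤ inner ℝ (M.reg d v) v * inner ℝ (M.reg d w) w := by
  have hq : ∀ t : ℝ, 0 ≤ inner ℝ (M.reg d w) w * (t * t)
      + 2 * inner ℝ (M.reg d v) w * t + inner ℝ (M.reg d v) v := by
    intro t
    have h1 := M.inner_reg_self_nonneg d hη (v + t • w)
    rw [reg_add, reg_smul, inner_add_left, inner_add_right, inner_add_right, inner_smul_left,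
      inner_smul_left, inner_smul_right, inner_smul_right, M.inner_reg_comm d w v,
      real_inner_comm (M.reg d v) w] at h1
    simp only [conj_trivial] at h1
    linarith
  have := discrim_le_zero hq
  unfold discrim at this
  linarith

/-- Apply the energy Cauchy–Schwarz inequality to `v` and N v, bound both energies by `ell`, and
cancel ‖N v‖². -/
lemma norm_reg_le (hη : 0 < M.η) (v : EuclideanSpace ℝ (Fin h)) :
    ‖M.reg d v‖ ≤ M.ell d * ‖v‖ := by
  have hl : 0 < M.ell d := hη.trans_le ((M.eta_le_mu d).trans (M.mu_le_ell d))
  have h1 := M.sq_inner_reg_le d hη v (M.reg d v)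
  rw [real_inner_self_eq_norm_sq] at h1
  have h2 := M.le_ell_mul d v
  have h3 := M.le_ell_mul d (M.reg d v)
  have h4 : (‖M.reg d v‖ ^ 2) ^ 2 ≤ (M.ell d * ‖v‖) ^ 2 * ‖M.reg d v‖ ^ 2 := by
    calc _ ≤ _ := h1
      _ ≤ (M.ell d * ‖v‖ ^ 2) * (M.ell d * ‖M.reg d v‖ ^ 2) :=
        mul_le_mul h2 h3 (M.inner_reg_self_nonneg d hη _) (by positivity)
      _ = _ := by ring
  rcases (norm_nonneg (M.reg d v)).eq_or_lt with hv | hv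
  · rw [← hv]; positivity
  · refine le_of_sq_le_sq ?_ (by positivity)
    refine le_of_mul_le_mul_right ?_ (pow_pos hv 2)
    linarith [pow_two (‖M.reg d v‖ ^ 2)]

/-- Coercivity makes N injective, hence surjective in finite dimension. This supplies the minimizer
of the inner loss. -/
lemma exists_reg_eq (hη : 0 < M.η) (b : EuclideanSpace ℝ (Fin h)) : ∃ v, M.reg d v = b := by
  let f : EuclideanSpace ℝ (Fin h) →ₗ[ℝ] EuclideanSpace ℝ (Fin h) :=
    { toFun := M.reg d, map_add' := M.reg_add d, map_smul' := M.reg_smul d }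
  have hinj : Function.Injective f := by
    rw [← LinearMap.ker_eq_bot, LinearMap.ker_eq_bot']
    intro v hv
    have h1 := M.mu_mul_le d v
    have h2 : M.reg d v = 0 := hv
    rw [h2, inner_zero_left] at h1
    have h3 : ‖v‖ ^ 2 ≤ 0 := by
      by_contra hc
      nlinarith [hη.trans_le (M.eta_le_mu d)]
    exact norm_eq_zero.1 (pow_eq_zero_iff two_ne_zero |>.1 (le_antisymm h3 (sq_nonneg _)))
  exact (LinearMap.injective_iff_surjective.1 hinj) b

/-- Regularization makes the Gram matrix positive definite, so the inverse in `regSolve` is a true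
inverse and the fixed-point equation becomes the normal equation. -/
lemma isRPBESolution_reg (hη : 0 < M.η) {θ : EuclideanSpace ℝ (Fin h)}
    (hθ : M.IsRPBESolution d θ) : M.reg d θ = M.proj d (M.bellman θ) := by
  have hdet : IsUnit (M.gram d + M.η • (1 : Matrix (Fin h) (Fin h) ℝ)).det := by
    rw [← Matrix.isUnit_iff_isUnit_det]
    refine (Matrix.PosDef.posSemidef_add (M.gram_posSemidef d) ?_).isUnit
    exact Matrix.PosDef.one.smul hη
  have h1 : (M.reg d θ).ofLp = (M.proj d (M.bellman θ)).ofLp := by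
    rw [reg_ofLp, hθ, regSolve, ← Matrix.mulVec_mulVec, Matrix.mulVec_mulVec,
      Matrix.mul_nonsing_inv _ hdet, Matrix.one_mulVec, featD_mulVec]
  exact (WithLp.ofLp_injective 2) h1

end

end Model

/-! ### Scalar inequalities -/

/-- The error terms of one step are absorbed by half of the squared gradient norm `n ^ 2`. -/
lemma step_error_le {μ l H T α n e Z a s m q : ℝ} (hμ : 0 < μ) (hμl : μ ≤ l) (hT : 1 ≤ T)
    (hH : 1 ≤ H) (hHl : H ≤ 1 + l) (hα0 : 0 ≤ α) (hn : 0 ≤ n) (he : 0 ≤ e) (hZ : 0 ≤ Z)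
    (ha : 0 ≤ a) (hs0 : 0 ≤ s) (hm : 0 ≤ m) (hs : s ^ 2 = l)
    (hα : α * (16 * (l * T * H * (1 + l))) ≤ μ ^ 2) (hen : μ * e ≤ n) (hZn : μ * Z ^ 2 ≤ n ^ 2)
    (haH : a ≤ H * e + (2 * m + q)) (hμq : μ * q ^ 2 ≤ m ^ 2) (hTq : q ^ 2 ≤ T * m ^ 2) :
    α * (3 / 2 * (l * T * a * (m + Z)) + 3 / 2 * (T * s * n * a) + 3 / 2 * (α * l * T * a ^ 2)
      + l * a ^ 2 / 2)
      ≤ n ^ 2 / 2 + α * (40 * (l * T * H ^ 2 * m ^ 2) + 3 / 2 * (l * T * m * q)) := by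
  have hl : 0 < l := hμ.trans_le hμl
  have hT0 : 0 < T := by linarith
  have hH0 : 0 < H := by linarith
  -- Since μ² ≤ μ l, one factor `l` cancels from `hα`. This form yields both smallness conditions,
  -- 16 α T ≤ μ and 16 α T ≤ 1.
  have hB : α * (16 * (T * H * (1 + l))) ≤ μ := by
    have h1 : (α * (16 * (T * H * (1 + l)))) * l ≤ μ * l := by
      nlinarith only [hα, mul_le_mul_of_nonneg_left hμl hμ.le]
    exact le_of_mul_le_mul_right h1 hl
  have hHl1 : 1 ≤ H * (1 + l) := by nlinarith only [hH, hl]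
  have hαT : 16 * (α * T) ≤ μ := by
    have h1 : α * T * 1 ≤ α * T * (H * (1 + l)) :=
      mul_le_mul_of_nonneg_left hHl1 (by positivity)
    linarith only [h1, hB]
  have hαT1 : 16 * (α * T) ≤ 1 := by
    have h1 : (16 * (α * T)) * (1 + l) ≤ 1 * (1 + l) := by
      have h2 : α * T * (1 + l) * 1 ≤ α * T * (1 + l) * H :=
        mul_le_mul_of_nonneg_left hH (by positivity)
      linarith only [h2, hB, hμl]
    exact le_of_mul_le_mul_right h1 (by linarith only [hl])
  have he2 : (μ * e) ^ 2 ≤ n ^ 2 := pow_le_pow_left₀ (by positivity) hen 2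
  have hA0 : α * (16 * (l * T * H * (1 + l))) * e ^ 2 ≤ n ^ 2 :=
    (mul_le_mul_of_nonneg_right hα (sq_nonneg e)).trans (by linarith only [he2])
  have hA1 : α * (l * T * H * e ^ 2) ≤ n ^ 2 / 16 := by
    have : 0 ≤ α * (l * T * H * e ^ 2) * l := by positivity
    have : 0 ≤ n ^ 2 := sq_nonneg n
    linarith only [this, ‹0 ≤ α * (l * T * H * e ^ 2) * l›, hA0]
  have hA3 : α * (l * H ^ 2 * e ^ 2) ≤ n ^ 2 / 16 := by
    have h1 : H * (α * l * H * e ^ 2) ≤ ((1 + l) * T) * (α * l * H * e ^ 2) := by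
      refine mul_le_mul_of_nonneg_right ?_ (by positivity)
      nlinarith only [hHl, hT, hl]
    linarith only [h1, hA0]
  have hZ0 : α * (16 * (l * T * H * (1 + l))) * Z ^ 2 ≤ μ * n ^ 2 :=
    (mul_le_mul_of_nonneg_right hα (sq_nonneg Z)).trans
      (by nlinarith only [mul_le_mul_of_nonneg_left hZn hμ.le])
  have hA2 : α * (l * T * H * Z ^ 2) ≤ n ^ 2 / 16 := by
    have h1 : (16 * (α * (l * T * H * Z ^ 2))) * (1 + l) ≤ n ^ 2 * (1 + l) := by
      have h2 := mul_le_mul_of_nonneg_right (hμl.trans (by linarith only : l ≤ 1 + l))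
        (sq_nonneg n)
      linarith only [h2, hZ0]
    have := le_of_mul_le_mul_right h1 (by linarith only [hl])
    linarith only [this]
  have hA2' : α * (l * T * (Z ^ 2 / μ)) ≤ n ^ 2 / 16 := by
    have h1 : (16 * (α * (l * T * (Z ^ 2 / μ)))) * μ ≤ n ^ 2 * μ := by
      have h2 : (16 * (α * (l * T * (Z ^ 2 / μ)))) * μ = 16 * (α * (l * T * Z ^ 2)) := by
        field_simp
      have h3 : 16 * (α * (l * T * Z ^ 2)) * 1
          ≤ 16 * (α * (l * T * Z ^ 2)) * (H * (1 + l)) :=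
        mul_le_mul_of_nonneg_left hHl1 (by positivity)
      linarith only [h2, h3, hZ0]
    have := le_of_mul_le_mul_right h1 hμ
    linarith only [this]
  -- the individual products
  have t1 : α * (l * T * (H * e) * Z) ≤ n ^ 2 / 16 := by
    have h1 : α * l * T * H * (2 * (e * Z)) ≤ α * l * T * H * (e ^ 2 + Z ^ 2) :=
      mul_le_mul_of_nonneg_left (by nlinarith only [sq_nonneg (e - Z)]) (by positivity)
    linarith only [h1, hA1, hA2]
  have t2 : α * (l * T * (H * e) * m) ≤ n ^ 2 / 64 + α * (l * T * H * m ^ 2) := by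
    have h1 : α * l * T * H * (e * m) ≤ α * l * T * H * (e ^ 2 / 4 + m ^ 2) :=
      mul_le_mul_of_nonneg_left (by nlinarith only [sq_nonneg (e / 2 - m)]) (by positivity)
    linarith only [h1, hA1]
  have t3 : α * (l * T * (2 * m) * Z) ≤ n ^ 2 / 96 + α * (6 * (l * T * m ^ 2)) := by
    have h1 : α * l * T * (2 * m * Z) ≤ α * l * T * (Z ^ 2 / 6 + 6 * m ^ 2) :=
      mul_le_mul_of_nonneg_left (by nlinarith only [sq_nonneg (Z - 6 * m)])
        (by positivity)
    have h2 : α * l * T * Z ^ 2 * 1 ≤ α * l * T * Z ^ 2 * H :=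
      mul_le_mul_of_nonneg_left hH (by positivity)
    linarith only [h1, h2, hA2]
  have t4 : α * (l * T * q * Z) ≤ n ^ 2 / 64 + α * (l * T * m ^ 2) := by
    -- Young's inequality with weight μ, so that the term in `q` is paid by `hμq` and the factor 1 /
    -- μ falls on `Z`, where `hA2'` absorbs it.
    have h0 : q * Z ≤ Z ^ 2 / μ / 4 + μ * q ^ 2 := by
      have h2 : Z ^ 2 / μ / 4 + μ * q ^ 2 - q * Z = (Z - 2 * μ * q) ^ 2 / (4 * μ) := by
        field_simp; ring
      have h3 : 0 ≤ (Z - 2 * μ * q) ^ 2 / (4 * μ) := by positivity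
      linarith only [h2, h3]
    have h1 : α * l * T * (q * Z) ≤ α * l * T * (Z ^ 2 / μ / 4 + m ^ 2) :=
      mul_le_mul_of_nonneg_left (by linarith only [h0, hμq]) (by positivity)
    linarith only [h1, hA2']
  have t5 : α * (T * s * n * (H * e)) ≤ n ^ 2 / 32 := by
    have h0 : 2 * s ≤ 1 + l := by nlinarith only [hs, sq_nonneg (s - 1)]
    have h1 : (α * T * H * n * e) * (2 * s) ≤ (α * T * H * n * e) * (1 + l) :=
      mul_le_mul_of_nonneg_left h0 (by positivity)
    have h2 : (α * (16 * (T * H * (1 + l)))) * (n * e) ≤ μ * (n * e) :=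
      mul_le_mul_of_nonneg_right hB (by positivity)
    have h3 : n * (μ * e) ≤ n * n := mul_le_mul_of_nonneg_left hen hn
    linarith only [h1, h2, h3]
  have t6 : α * (T * s * n * (2 * m)) ≤ n ^ 2 / 96 + α * (6 * (l * T * m ^ 2)) := by
    have h0 : s * n * (2 * m) ≤ n ^ 2 / 6 + 6 * (l * m ^ 2) := by
      rw [← hs]; nlinarith only [sq_nonneg (n - 6 * (s * m))]
    have h1 : α * T * (s * n * (2 * m)) ≤ α * T * (n ^ 2 / 6 + 6 * (l * m ^ 2)) :=
      mul_le_mul_of_nonneg_left h0 (by positivity)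
    have h2 : (16 * (α * T)) * n ^ 2 ≤ 1 * n ^ 2 :=
      mul_le_mul_of_nonneg_right hαT1 (sq_nonneg n)
    linarith only [h1, h2]
  have t7 : α * (T * s * n * q) ≤ n ^ 2 / 64 + α * (l * T * m ^ 2) := by
    have h0 : s * n * q ≤ n ^ 2 / μ / 4 + l * (μ * q ^ 2) := by
      have h2 : n ^ 2 / μ / 4 + l * (μ * q ^ 2) - s * n * q
          = (n - 2 * μ * s * q) ^ 2 / (4 * μ) := by
        rw [← hs]; field_simp; ring
      have h3 : 0 ≤ (n - 2 * μ * s * q) ^ 2 / (4 * μ) := by positivity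
      linarith only [h2, h3]
    have h1 : α * T * (s * n * q) ≤ α * T * (n ^ 2 / μ / 4 + l * m ^ 2) := by
      refine mul_le_mul_of_nonneg_left (h0.trans ?_) (by positivity)
      have := mul_le_mul_of_nonneg_left hμq hl.le
      linarith only [this]
    have h2 : (16 * (α * T)) * (n ^ 2 / μ) ≤ μ * (n ^ 2 / μ) :=
      mul_le_mul_of_nonneg_right hαT (by positivity)
    have h3 : μ * (n ^ 2 / μ) = n ^ 2 := by field_simp
    linarith only [h1, h2, h3]
  have t8 : α * (l * a ^ 2) ≤ n ^ 2 / 8 + α * (20 * (l * T * m ^ 2)) := by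
    -- Here `q` is controlled by `hTq`, avoiding a factor 1 / μ: 2 (2 m + q)² ≤ 16 m² + 4 q² ≤ 20 T
    -- m².
    have h0 : a ^ 2 ≤ 2 * (H ^ 2 * e ^ 2) + 20 * (T * m ^ 2) := by
      have h1 : a ^ 2 ≤ (H * e + (2 * m + q)) ^ 2 := pow_le_pow_left₀ ha haH 2
      have h2 : m ^ 2 * 1 ≤ m ^ 2 * T := mul_le_mul_of_nonneg_left hT (sq_nonneg m)
      nlinarith only [h1, h2, hTq, sq_nonneg (H * e - (2 * m + q)), sq_nonneg (2 * m - q)]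
    have h1 : α * l * a ^ 2 ≤ α * l * (2 * (H ^ 2 * e ^ 2) + 20 * (T * m ^ 2)) :=
      mul_le_mul_of_nonneg_left h0 (by positivity)
    linarith only [h1, hA3]
  have t9 : α * (α * l * T * a ^ 2) ≤ α * (l * a ^ 2) / 16 := by
    have h1 : (16 * (α * T)) * (α * (l * a ^ 2)) ≤ 1 * (α * (l * a ^ 2)) :=
      mul_le_mul_of_nonneg_right hαT1 (by positivity)
    linarith only [h1]
  have t10 : α * (l * T * a * (m + Z))
      ≤ α * (l * T * (H * e + (2 * m + q)) * (m + Z)) := by gcongr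
  have t11 : α * (T * s * n * a) ≤ α * (T * s * n * (H * e + (2 * m + q))) := by gcongr
  have hHm : α * (l * T * m ^ 2) * H ≤ α * (l * T * m ^ 2) * H ^ 2 :=
    mul_le_mul_of_nonneg_left (by nlinarith only [hH]) (by positivity)
  have hHm1 : α * (l * T * m ^ 2) * 1 ≤ α * (l * T * m ^ 2) * H ^ 2 :=
    mul_le_mul_of_nonneg_left (by nlinarith only [hH]) (by positivity)
  have hn2 : 0 ≤ n ^ 2 := sq_nonneg n
  have hm2 : 0 ≤ α * (l * T * m ^ 2) * H ^ 2 := by positivity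
  -- The product of `q` and `m` is the only term not reduced to `n ^ 2` or `m ^ 2`; it is passed on
  -- to `budget_le`.
  linarith only [t1, t2, t3, t4, t5, t6, t7, t8, t9, t10, t11, hHm, hHm1, hn2, hm2]

/-- The error terms independent of the distance to the minimizer are dominated by `ℰ₁`, `ℰ₂`. -/
lemma budget_le {μ l H T γ R p c m q w Θ σ lV1 lV2 lV3 κ D1 G : ℝ} (hμ : 0 < μ) (hμl : μ ≤ l)
    (hT : 1 ≤ T) (hH : 1 ≤ H) (hγ0 : 0 ≤ γ) (hγ1 : γ ≤ 1) (hR : 0 ≤ R) (hp : 0 ≤ p) (hc : 0 ≤ c)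
    (hΘ : 0 ≤ Θ) (hσ : 0 ≤ σ)
    (hm : m = R + γ * p + γ * c) (hq : q ≤ Θ + w) (hμw : μ * w ^ 2 ≤ (γ * c) ^ 2)
    (hlV1 : lV1 = 2 * T * H) (hlV2 : 0 ≤ lV2) (hlV3 : T * Θ ≤ lV3) (hκ : κ = l / μ)
    (hD1 : D1 = l * (6 * lV1 + lV3) + κ * lV1 * γ)
    (hG : G = (10 + 32 * H) * γ ^ 2 * c ^ 2
      + (32 * H * γ ^ 2 * p ^ 2 + 16 * H * R ^ 2 + 8 * σ)) :
    40 * (l * T * H ^ 2 * m ^ 2) + 3 / 2 * (l * T * m * q)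
      ≤ (D1 + l / 2) * G + (κ * lV1 + l * lV2) * c ^ 2 + 2 * l * lV3 := by
  have hl : 0 < l := hμ.trans_le hμl
  have hT0 : 0 < T := by linarith
  have hH0 : 0 < H := by linarith
  have hκ0 : 0 < κ := by rw [hκ]; positivity
  have hlκ : l = κ * μ := by rw [hκ]; field_simp
  have hm0 : 0 ≤ m := by rw [hm]; positivity
  have hlV30 : 0 ≤ lV3 := (mul_nonneg hT0.le hΘ).trans hlV3
  have hGm : 8 * H * m ^ 2 ≤ G := by
    have h1 : m ^ 2 ≤ 2 * R ^ 2 + 4 * (γ * p) ^ 2 + 4 * (γ * c) ^ 2 := by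
      rw [hm]
      nlinarith only [sq_nonneg (R - γ * p - γ * c), sq_nonneg (γ * p - γ * c)]
    have h2 : 8 * H * m ^ 2 ≤ 8 * H * (2 * R ^ 2 + 4 * (γ * p) ^ 2 + 4 * (γ * c) ^ 2) :=
      mul_le_mul_of_nonneg_left h1 (by positivity)
    have h3 : 0 ≤ 10 * γ ^ 2 * c ^ 2 := by positivity
    rw [hG]; linarith only [h2, h3, hσ]
  have hG0 : 0 ≤ G := le_trans (by positivity) hGm
  -- The first summand will pay for the terms in `m ^ 2`, the second for the part of `q` coming from
  -- `Θ`.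
  have hD : 12 * (l * T * H) + l * lV3 ≤ D1 + l / 2 := by
    have h1 : 0 ≤ κ * lV1 * γ := by rw [hlV1]; positivity
    rw [hD1, hlV1]; rw [hlV1] at h1; linarith only [h1, hl]
  have h1 : (12 * (l * T * H) + l * lV3) * (8 * H * m ^ 2) ≤ (D1 + l / 2) * G :=
    mul_le_mul hD hGm (by positivity) (le_trans (by positivity) hD)
  have h2 : l * T * m * q ≤ l * T * m * Θ + l * T * m * w := by
    have := mul_le_mul_of_nonneg_left hq (show 0 ≤ l * T * m by positivity)
    linarith only [this]
  have h3 : l * T * m * w ≤ l * T * (m ^ 2 + w ^ 2) / 2 := by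
    have := mul_le_mul_of_nonneg_left (show 2 * (m * w) ≤ m ^ 2 + w ^ 2 by
      nlinarith only [sq_nonneg (m - w)]) (show 0 ≤ l * T by positivity)
    linarith only [this]
  -- Writing l = κ μ lets `hμw` apply directly; the result is charged to the κ lV1 c² part of the
  -- budget.
  have h4 : l * T * w ^ 2 ≤ κ * T * c ^ 2 := by
    have h5 : (γ * c) ^ 2 ≤ c ^ 2 := pow_le_pow_left₀ (by positivity) (mul_le_of_le_one_left hc hγ1) 2
    have := mul_le_mul_of_nonneg_left (hμw.trans h5) (show 0 ≤ κ * T by positivity)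
    rw [hlκ]; linarith only [this]
  have h5 : κ * T * c ^ 2 ≤ κ * T * c ^ 2 * H := le_mul_of_one_le_right (by positivity) hH
  have h6 : l * T * m * Θ ≤ l * lV3 * m := by
    have := mul_le_mul_of_nonneg_left hlV3 (show 0 ≤ l * m by positivity)
    linarith only [this]
  -- A linear term in `m` is traded for a square through 8 m ≤ 8 m² + 2; the constant 2 is what the
  -- summand 2 l lV3 covers.
  have h7 : l * lV3 * (8 * m) ≤ l * lV3 * (8 * H * m ^ 2 + 2) := by
    refine mul_le_mul_of_nonneg_left ?_ (by positivity)
    have : m ^ 2 ≤ H * m ^ 2 := le_mul_of_one_le_left (sq_nonneg m) hH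
    nlinarith only [this, sq_nonneg (2 * m - 1)]
  have h8 : l * T * m ^ 2 * 1 ≤ l * T * m ^ 2 * H ^ 2 :=
    mul_le_mul_of_nonneg_left (by nlinarith only [hH]) (by positivity)
  have h9 : 0 ≤ l * lV2 * c ^ 2 := by positivity
  have h10 : 0 ≤ l * lV3 * m := by positivity
  have h11 : 0 ≤ l * T * m ^ 2 * H ^ 2 := by positivity
  have h12 : 0 ≤ κ * T * c ^ 2 * H := by positivity
  rw [hlV1]
  linarith only [h1, h2, h3, h4, h5, h6, h7, h8, h9, h10, h11, h12]

/-! ### The Bellman operator and the quadratic inner loss -/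

namespace Model

variable {S A : Type*} {h : ℕ} (M : Model S A h)

lemma abs_sum_pmf_mul_le {X : Type*} [Fintype X] (p : PMF X) (f : X → ℝ) {C : ℝ}
    (hf : ∀ x, |f x| ≤ C) : |∑ x, (p x).toReal * f x| ≤ C := by
  calc |∑ x, (p x).toReal * f x| ≤ ∑ x, |(p x).toReal * f x| := Finset.abs_sum_le_sum_abs _ _
    _ ≤ ∑ x, (p x).toReal * C := Finset.sum_le_sum fun x _ => by
        rw [abs_mul, abs_of_nonneg ENNReal.toReal_nonneg]
        exact mul_le_mul_of_nonneg_left (hf x) ENNReal.toReal_nonneg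
    _ = C := by rw [← Finset.sum_mul, sum_toReal_pmf, one_mul]

/-- The sampled Bellman target `r(s, a, s') + γ max_u φ(s', u)ᵀ θ`. -/
def sampleTarget (θ : EuclideanSpace ℝ (Fin h)) (x : S × A) (s' : S) : ℝ :=
  M.reward x.1 x.2 s' + M.γ * M.maxVal θ s'

variable [Fintype S]

lemma meanGrad_eq (θ θ' : EuclideanSpace ℝ (Fin h)) (x : S × A) :
    M.meanGrad θ θ' x = (M.lin θ x - M.bellman θ' x) • M.feat x.1 x.2 + M.η • θ := by
  have h1 : ∀ s', M.sgrad θ θ' x s'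
      = (M.lin θ x - M.sampleTarget θ' x s') • M.feat x.1 x.2 + M.η • θ := by
    intro s'
    simp only [sgrad, lin, sampleTarget, smul_neg, ← neg_smul]
    congr 2; ring
  have h2 : ∑ s', (M.trans x.1 x.2 s').toReal * (M.lin θ x - M.sampleTarget θ' x s')
      = M.lin θ x - M.bellman θ' x := by
    simp only [mul_sub, Finset.sum_sub_distrib, ← Finset.sum_mul, sum_toReal_pmf, one_mul]
    rfl
  simp only [meanGrad, h1, smul_add, smul_smul, Finset.sum_add_distrib, ← Finset.sum_smul, h2]
  rw [← Finset.sum_mul, sum_toReal_pmf, one_mul]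

variable [Fintype A]

lemma abs_inner_feat_le_norm_lin (θ : EuclideanSpace ℝ (Fin h)) (s : S)
    (u : A) : |inner ℝ (M.feat s u) θ| ≤ ‖M.lin θ‖ :=
  norm_le_pi_norm (M.lin θ) (s, u)

lemma abs_maxVal_sub_le [Nonempty A] (θ θ' : EuclideanSpace ℝ (Fin h))
    (s : S) : |M.maxVal θ s - M.maxVal θ' s| ≤ ‖M.lin (θ - θ')‖ := by
  have key : ∀ a b : EuclideanSpace ℝ (Fin h),
      M.maxVal a s ≤ M.maxVal b s + ‖M.lin (a - b)‖ := by
    intro a b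
    refine ciSup_le fun u => ?_
    have h1 : inner ℝ (M.feat s u) b ≤ M.maxVal b s :=
      le_ciSup (f := fun u => inner ℝ (M.feat s u) b) (Set.finite_range _).bddAbove u
    have h2 := (abs_le.1 (M.abs_inner_feat_le_norm_lin (a - b) s u)).2
    rw [inner_sub_right] at h2
    linarith
  have h1 := key θ θ'
  have h2 := key θ' θ
  have h3 : ‖M.lin (θ' - θ)‖ = ‖M.lin (θ - θ')‖ := by
    rw [lin_sub, lin_sub, norm_sub_rev]
  rw [abs_le]
  constructor <;> linarith

lemma abs_maxVal_le [Nonempty A] (θ : EuclideanSpace ℝ (Fin h))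
    (s : S) : |M.maxVal θ s| ≤ ‖M.lin θ‖ := by
  have h1 := M.abs_maxVal_sub_le θ 0 s
  have h2 : M.maxVal 0 s = 0 := by simp [maxVal]
  rwa [h2, sub_zero, sub_zero] at h1

lemma abs_sampleTarget_le [Nonempty A] (hγ0 : 0 ≤ M.γ) {Rmax : ℝ}
    (hR : ∀ s a s', |M.reward s a s'| ≤ Rmax) (θ θ' : EuclideanSpace ℝ (Fin h)) (x : S × A)
    (s' : S) :
    |M.sampleTarget θ x s'| ≤ Rmax + M.γ * ‖M.lin θ'‖ + M.γ * ‖M.lin (θ - θ')‖ := by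
  have h1 : |M.maxVal θ s'| ≤ ‖M.lin θ'‖ + ‖M.lin (θ - θ')‖ := by
    have h2 := M.abs_maxVal_sub_le θ θ' s'
    have h3 := M.abs_maxVal_le θ' s'
    have h4 : M.maxVal θ s' = (M.maxVal θ s' - M.maxVal θ' s') + M.maxVal θ' s' := by ring
    rw [h4]
    exact (abs_add_le _ _).trans (by linarith)
  calc |M.sampleTarget θ x s'| ≤ |M.reward x.1 x.2 s'| + |M.γ * M.maxVal θ s'| := abs_add_le _ _
    _ ≤ Rmax + M.γ * (‖M.lin θ'‖ + ‖M.lin (θ - θ')‖) := by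
        rw [abs_mul, abs_of_nonneg hγ0]
        exact add_le_add (hR _ _ _) (mul_le_mul_of_nonneg_left h1 hγ0)
    _ = _ := by ring

lemma abs_bellman_le [Nonempty A] (hγ0 : 0 ≤ M.γ) {Rmax : ℝ}
    (hR : ∀ s a s', |M.reward s a s'| ≤ Rmax) (θ θ' : EuclideanSpace ℝ (Fin h)) (x : S × A) :
    |M.bellman θ x| ≤ Rmax + M.γ * ‖M.lin θ'‖ + M.γ * ‖M.lin (θ - θ')‖ :=
  abs_sum_pmf_mul_le _ _ fun s' => M.abs_sampleTarget_le hγ0 hR θ θ' x s'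

lemma abs_bellman_sub_le [Nonempty A] (hγ0 : 0 ≤ M.γ) (θ θ' : EuclideanSpace ℝ (Fin h))
    (x : S × A) : |M.bellman θ x - M.bellman θ' x| ≤ M.γ * ‖M.lin (θ - θ')‖ := by
  have h1 : M.bellman θ x - M.bellman θ' x = ∑ s', (M.trans x.1 x.2 s').toReal
      * (M.γ * (M.maxVal θ s' - M.maxVal θ' s')) := by
    simp only [bellman, ← Finset.sum_sub_distrib]
    exact Finset.sum_congr rfl fun s' _ => by ring
  rw [h1]
  refine abs_sum_pmf_mul_le _ _ fun s' => ?_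
  rw [abs_mul, abs_of_nonneg hγ0]
  exact mul_le_mul_of_nonneg_left (M.abs_maxVal_sub_le θ θ' s') hγ0

section Loss

variable (d : PMF (S × A))

/-- The expansion has no Taylor remainder. It gives the gradient, the excess loss over the
minimizer, and the exactness of `loss_step`. -/
lemma loss_add (θ w θ' : EuclideanSpace ℝ (Fin h)) :
    M.loss d (θ + w) θ' = M.loss d θ θ'
      + inner ℝ (M.reg d θ - M.proj d (M.bellman θ')) w + 1 / 2 * inner ℝ (M.reg d w) w := by
  have h1 : ∑ x, (d x).toReal * (M.bellman θ' x - M.lin (θ + w) x) ^ 2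
      = ∑ x, (d x).toReal * (M.bellman θ' x - M.lin θ x) ^ 2
        + 2 * ∑ x, (d x).toReal * (M.lin θ x * M.lin w x)
        - 2 * ∑ x, (d x).toReal * (M.bellman θ' x * M.lin w x)
        + ∑ x, (d x).toReal * (M.lin w x * M.lin w x) := by
    simp only [Finset.mul_sum, ← Finset.sum_add_distrib, ← Finset.sum_sub_distrib]
    refine Finset.sum_congr rfl fun x _ => ?_
    rw [lin_add, Pi.add_apply]; ring
  rw [loss, loss, h1, inner_sub_left, inner_reg, inner_reg, inner_proj, norm_add_sq_real,
    real_inner_self_eq_norm_sq]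
  ring

lemma lossGrad_eq (hη : 0 < M.η) (θ θ' : EuclideanSpace ℝ (Fin h)) :
    M.lossGrad d θ θ' = M.reg d θ - M.proj d (M.bellman θ') := by
  refine HasGradientAt.gradient ?_
  rw [hasGradientAt_iff_isLittleO]
  have h1 : (fun z => M.loss d z θ' - M.loss d θ θ'
      - inner ℝ (M.reg d θ - M.proj d (M.bellman θ')) (z - θ))
      = fun z => 1 / 2 * inner ℝ (M.reg d (z - θ)) (z - θ) := by
    funext z
    have := M.loss_add d θ (z - θ) θ'
    rw [add_sub_cancel] at this
    rw [this]; ring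
  rw [h1]
  have h2 : (fun z : EuclideanSpace ℝ (Fin h) => 1 / 2 * inner ℝ (M.reg d (z - θ)) (z - θ))
      =O[nhds θ] fun z => ‖z - θ‖ ^ 2 := by
    refine Asymptotics.IsBigO.of_bound (M.ell d / 2) (Filter.Eventually.of_forall fun z => ?_)
    have h3 := M.inner_reg_self_nonneg d hη (z - θ)
    have h4 := M.le_ell_mul d (z - θ)
    rw [Real.norm_of_nonneg (by positivity), Real.norm_of_nonneg (by positivity)]
    linarith
  refine h2.trans_isLittleO ?_
  have hlim : Filter.Tendsto (fun z => z - θ) (nhds θ) (nhds 0) :=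
    (continuous_id.sub continuous_const).tendsto' θ 0 (sub_self θ)
  exact (Asymptotics.isLittleO_norm_pow_id one_lt_two).comp_tendsto hlim

lemma loss_eq_of_reg_eq {θm θ' : EuclideanSpace ℝ (Fin h)}
    (hθm : M.reg d θm = M.proj d (M.bellman θ')) (θ : EuclideanSpace ℝ (Fin h)) :
    M.loss d θ θ' = M.loss d θm θ' + 1 / 2 * inner ℝ (M.reg d (θ - θm)) (θ - θm) := by
  have := M.loss_add d θm (θ - θm) θ'
  rwa [add_sub_cancel, hθm, sub_self, inner_zero_left, add_zero] at this

/-- `innerArgmin` is an unspecified choice. A solution of the normal equation shows that minimizers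
exist, so the choice is one of them, and only the minimal value matters. -/
lemma loss_innerArgmin (hη : 0 < M.η) {θm θ' : EuclideanSpace ℝ (Fin h)}
    (hθm : M.reg d θm = M.proj d (M.bellman θ')) :
    M.loss d (M.innerArgmin d θ') θ' = M.loss d θm θ' := by
  have hmin : ∀ u, M.loss d θm θ' ≤ M.loss d u θ' := by
    intro u
    rw [M.loss_eq_of_reg_eq d hθm u]
    linarith [M.inner_reg_self_nonneg d hη (u - θm)]
  have hspec : ∀ u, M.loss d (M.innerArgmin d θ') θ' ≤ M.loss d u θ' :=
    Classical.epsilon_spec (p := fun v => ∀ u, M.loss d v θ' ≤ M.loss d u θ') ⟨θm, hmin⟩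
  exact le_antisymm (hspec _) (hmin _)

/-- Energy identity of ridge regression. -/
lemma reg_eq_proj_energy {w : EuclideanSpace ℝ (Fin h)} {f : S × A → ℝ}
    (hw : M.reg d w = M.proj d f) :
    inner ℝ (M.reg d w) w + ∑ x, (d x).toReal * (f x - M.lin w x) ^ 2 + M.η * ‖w‖ ^ 2
      = ∑ x, (d x).toReal * f x ^ 2 := by
  have h1 : ∑ x, (d x).toReal * (f x - M.lin w x) ^ 2
      = ∑ x, (d x).toReal * f x ^ 2 - 2 * ∑ x, (d x).toReal * (f x * M.lin w x)
        + ∑ x, (d x).toReal * (M.lin w x * M.lin w x) := by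
    rw [Finset.mul_sum, ← Finset.sum_sub_distrib, ← Finset.sum_add_distrib]
    exact Finset.sum_congr rfl fun x _ => by ring
  have h2 := M.inner_reg d w w
  have h3 := M.inner_proj d f w
  rw [← hw] at h3
  rw [real_inner_self_eq_norm_sq] at h2
  rw [h1]
  linarith

lemma sq_norm_proj_le (hfeat : ∀ s a, ‖M.feat s a‖ ≤ 1) (f : S × A → ℝ) :
    ‖M.proj d f‖ ^ 2 ≤ ∑ x, (d x).toReal * f x ^ 2 := by
  refine (sq_norm_sum_smul_le _ (fun x => ENNReal.toReal_nonneg) _).trans ?_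
  rw [sum_toReal_pmf, one_mul]
  refine Finset.sum_le_sum fun x _ => mul_le_mul_of_nonneg_left ?_ ENNReal.toReal_nonneg
  rw [norm_smul, mul_pow, Real.norm_eq_abs, sq_abs]
  exact mul_le_of_le_one_right (sq_nonneg _) (pow_le_one₀ (norm_nonneg _) (hfeat _ _))

lemma sum_pmf_mul_sq_le (f : S × A → ℝ) {C : ℝ} (hf : ∀ x, |f x| ≤ C) :
    ∑ x, (d x).toReal * f x ^ 2 ≤ C ^ 2 := by
  have := abs_sum_pmf_mul_le d (fun x => f x ^ 2) (C := C ^ 2) fun x => by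
    rw [abs_of_nonneg (sq_nonneg _), ← sq_abs]
    exact pow_le_pow_left₀ (abs_nonneg _) (hf x) 2
  exact (le_abs_self _).trans this

lemma sum_lin_sq_le_inner (hη : 0 < M.η) (v : EuclideanSpace ℝ (Fin h)) :
    ∑ x, (d x).toReal * M.lin v x ^ 2 ≤ inner ℝ (M.reg d v) v := by
  rw [inner_reg, real_inner_self_eq_norm_sq]
  simp only [← pow_two]
  have : 0 ≤ M.η * ‖v‖ ^ 2 := by positivity
  linarith

lemma sum_lin_sq_le_norm (hfeat : ∀ s a, ‖M.feat s a‖ ≤ 1) (v : EuclideanSpace ℝ (Fin h)) :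
    ∑ x, (d x).toReal * M.lin v x ^ 2 ≤ ‖v‖ ^ 2 :=
  sum_pmf_mul_sq_le d _ fun x => M.abs_lin_le hfeat v x

end Loss

end Model

/-! ### The Poisson solution and the exact one-step identity -/

namespace Model

variable {S A : Type*} {h : ℕ} (M : Model S A h) [Fintype S] [Fintype A]

section Poisson

variable (d : PMF (S × A))

open scoped Classical in
/-- The linear part `θ ↦ V(θ, θ', x) - V(0, θ', x)` of the solution of Poisson's equation. -/
def poissonLin (y x : S × A) (g : EuclideanSpace ℝ (Fin h)) : EuclideanSpace ℝ (Fin h) :=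
  ∑ z, occupation M.stepMatrix y x z •
    (M.lin g z • M.feat z.1 z.2 - ∑ j, (d j).toReal • (M.lin g j • M.feat j.1 j.2))

lemma poissonLin_smul (y x : S × A) (c : ℝ) (g : EuclideanSpace ℝ (Fin h)) :
    M.poissonLin d y x (c • g) = c • M.poissonLin d y x g := by
  simp only [poissonLin, lin_smul, Pi.smul_apply, smul_eq_mul, mul_smul]
  simp only [smul_comm _ c, ← Finset.smul_sum, ← smul_sub]

/-- The regularization terms cancel, leaving residual times feature minus its stationary mean, the
centred form needed for the L²(d) bound. -/
lemma meanGrad_sub_lossGrad (hη : 0 < M.η) (θ θ' : EuclideanSpace ℝ (Fin h)) (x : S × A) :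
    M.meanGrad θ θ' x - M.lossGrad d θ θ'
      = (M.lin θ x - M.bellman θ' x) • M.feat x.1 x.2
        - ∑ j, (d j).toReal • ((M.lin θ j - M.bellman θ' j) • M.feat j.1 j.2) := by
  rw [meanGrad_eq, M.lossGrad_eq d hη, reg, proj]
  simp only [sub_smul, smul_sub, Finset.sum_sub_distrib]
  abel

lemma sum_meanGrad_sub_lossGrad (hη : 0 < M.η) (θ θ' : EuclideanSpace ℝ (Fin h)) :
    ∑ x, (d x).toReal • (M.meanGrad θ θ' x - M.lossGrad d θ θ') = 0 := by
  simp only [M.meanGrad_sub_lossGrad d hη, smul_sub]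
  rw [Finset.sum_sub_distrib, ← Finset.sum_smul, sum_toReal_pmf, one_smul, sub_self]

lemma sq_norm_smul_feat_le (hfeat : ∀ s a, ‖M.feat s a‖ ≤ 1) (f : S × A → ℝ) :
    ∑ z, (d z).toReal * ‖f z • M.feat z.1 z.2‖ ^ 2 ≤ ∑ z, (d z).toReal * f z ^ 2 := by
  refine Finset.sum_le_sum fun x _ => mul_le_mul_of_nonneg_left ?_ ENNReal.toReal_nonneg
  rw [norm_smul, mul_pow, Real.norm_eq_abs, sq_abs]
  exact mul_le_of_le_one_right (sq_nonneg _) (pow_le_one₀ (norm_nonneg _) (hfeat _ _))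

variable [MeasurableSpace S] [DiscreteMeasurableSpace S]
  [MeasurableSpace A] [DiscreteMeasurableSpace A]

-- Turns the path integral into a finite sum, from which affinity, bounds and continuity in the
-- parameters can be read off.
open scoped Classical in
lemma poisson_eq_sum (hirr : M.stepMatrix.IsIrreducible) (y : S × A)
    (θ θ' : EuclideanSpace ℝ (Fin h)) (x : S × A) :
    M.poisson d y θ θ' x = ∑ z, occupation M.stepMatrix y x z
      • (M.meanGrad θ θ' z - M.lossGrad d θ θ') :=
  M.integral_sum_hitTime hirr (fun z => M.meanGrad θ θ' z - M.lossGrad d θ θ') x y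

lemma poisson_add (hη : 0 < M.η) (hirr : M.stepMatrix.IsIrreducible) (y : S × A)
    (θ w θ' : EuclideanSpace ℝ (Fin h)) (x : S × A) :
    M.poisson d y (θ + w) θ' x = M.poisson d y θ θ' x + M.poissonLin d y x w := by
  rw [M.poisson_eq_sum d hirr, M.poisson_eq_sum d hirr, poissonLin, ← Finset.sum_add_distrib]
  refine Finset.sum_congr rfl fun z _ => ?_
  rw [← smul_add, M.meanGrad_sub_lossGrad d hη, M.meanGrad_sub_lossGrad d hη, lin_add]
  congr 1
  simp only [Pi.add_apply, sub_smul, add_smul, smul_sub, smul_add, Finset.sum_sub_distrib,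
    Finset.sum_add_distrib]
  abel

lemma poisson_step (hη : 0 < M.η) (hirr : M.stepMatrix.IsIrreducible) (hd : M.IsStationary d)
    (y : S × A) (θ θ' : EuclideanSpace ℝ (Fin h)) (x : S × A) :
    M.meanGrad θ θ' x = M.lossGrad d θ θ' + M.poisson d y θ θ' x
      - ∑ z, M.stepMatrix x z • M.poisson d y θ θ' z := by
  classical
  have h1 := poisson_eq M.stepMatrix_nonneg M.sum_stepMatrix hirr (sum_toReal_pmf d)
    (M.stationary_sum hd) _ (M.sum_meanGrad_sub_lossGrad d hη θ θ') y x
  simp only [M.poisson_eq_sum d hirr]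
  rw [h1]; abel

lemma one_le_tauMax (hirr : M.stepMatrix.IsIrreducible) (y : S × A) : 1 ≤ M.tauMax := by
  classical
  exact (one_le_meanHit M.stepMatrix_nonneg M.sum_stepMatrix hirr y y).trans
    (M.meanHit_le_tauMax hirr y y)

lemma one_le_tauMax_mul (hirr : M.stepMatrix.IsIrreducible) (hd : M.IsStationary d)
    (x : S × A) : 1 ≤ M.tauMax * (d x).toReal := by
  classical
  exact one_le_mul_stationary M.stepMatrix_nonneg M.sum_stepMatrix hirr (sum_toReal_pmf d)
    (M.stationary_sum hd) (M.meanHit_le_tauMax hirr) x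

/-- From `X² ≤ 2 T² Y` and `Y ≤ Z²` to `X ≤ (3/2) T Z`. -/
lemma le_mul_of_sq_le {X T Y Z : ℝ} (hT : 0 ≤ T) (hZ : 0 ≤ Z) (h1 : X ^ 2 ≤ 2 * T ^ 2 * Y)
    (h2 : Y ≤ Z ^ 2) : X ≤ 3 / 2 * (T * Z) := by
  refine abs_le_of_sq_le_sq' ?_ (by positivity) |>.2
  have h3 := mul_le_mul_of_nonneg_left h2 (show 0 ≤ 2 * T ^ 2 by positivity)
  have h4 : 0 ≤ T ^ 2 * Z ^ 2 := by positivity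
  linarith only [h1, h3, h4, mul_pow T Z 2]

lemma norm_poissonLin_le (hfeat : ∀ s a, ‖M.feat s a‖ ≤ 1) (hirr : M.stepMatrix.IsIrreducible)
    (hd : M.IsStationary d) (y x : S × A) (g : EuclideanSpace ℝ (Fin h)) {C : ℝ} (hC : 0 ≤ C)
    (hgC : ∑ z, (d z).toReal * M.lin g z ^ 2 ≤ C ^ 2) :
    ‖M.poissonLin d y x g‖ ≤ 3 / 2 * (M.tauMax * C) := by
  classical
  have h1 := sq_norm_occupation_sum_centred_le M.stepMatrix_nonneg M.sum_stepMatrix hirr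
    (sum_toReal_pmf d) (M.stationary_sum hd) (M.meanHit_le_tauMax hirr)
    (fun z => M.lin g z • M.feat z.1 z.2) y x
  exact le_mul_of_sq_le (zero_le_one.trans (M.one_le_tauMax hirr y)) hC h1
    ((M.sq_norm_smul_feat_le d hfeat _).trans hgC)

lemma norm_poisson_le (hη : 0 < M.η) (hfeat : ∀ s a, ‖M.feat s a‖ ≤ 1)
    (hirr : M.stepMatrix.IsIrreducible)
    (hd : M.IsStationary d) (y x : S × A) (θ θ' : EuclideanSpace ℝ (Fin h)) {C : ℝ} (hC : 0 ≤ C)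
    (hgC : ∑ z, (d z).toReal * (M.lin θ z - M.bellman θ' z) ^ 2 ≤ C ^ 2) :
    ‖M.poisson d y θ θ' x‖ ≤ 3 / 2 * (M.tauMax * C) := by
  classical
  have h1 := sq_norm_occupation_sum_centred_le M.stepMatrix_nonneg M.sum_stepMatrix hirr
    (sum_toReal_pmf d) (M.stationary_sum hd) (M.meanHit_le_tauMax hirr)
    (fun z => (M.lin θ z - M.bellman θ' z) • M.feat z.1 z.2) y x
  rw [M.poisson_eq_sum d hirr]
  simp only [M.meanGrad_sub_lossGrad d hη]
  exact le_mul_of_sq_le (zero_le_one.trans (M.one_le_tauMax hirr y)) hC h1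
    ((M.sq_norm_smul_feat_le d hfeat _).trans hgC)

end Poisson

section Descent

variable (d : PMF (S × A)) [MeasurableSpace S] [DiscreteMeasurableSpace S]
  [MeasurableSpace A] [DiscreteMeasurableSpace A]

/-- The second-order remainder of one stochastic gradient step from `θ` along `g`, when the next
state-action pair is `z` and `b` is the gradient of the loss at `θ`. -/
def remainder (y : S × A) (α : ℝ) (b g V : EuclideanSpace ℝ (Fin h)) (z : S × A) : ℝ :=
  inner ℝ (M.reg d g) V + inner ℝ b (M.poissonLin d y z g)
    - α * inner ℝ (M.reg d g) (M.poissonLin d y z g) + 1 / 2 * inner ℝ (M.reg d g) g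

/-- The loss is quadratic, while its gradient and V are affine in `θ`. Replacing old parameters by
new ones in the drift therefore produces finitely many bilinear terms, collected in `remainder`. -/
lemma loss_step (hη : 0 < M.η) (hirr : M.stepMatrix.IsIrreducible) (y : S × A) (α : ℝ)
    (θ θ' g : EuclideanSpace ℝ (Fin h)) (z : S × A) :
    M.loss d (θ - α • g) θ' - M.loss d θ θ'
      = -α * inner ℝ (M.lossGrad d θ θ') g
        + α * (inner ℝ (M.lossGrad d (θ - α • g) θ') (M.poisson d y (θ - α • g) θ' z)
          - inner ℝ (M.lossGrad d θ θ') (M.poisson d y θ θ' z))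
        + α ^ 2 * M.remainder d y α (M.lossGrad d θ θ') g (M.poisson d y θ θ' z) z := by
  have e : θ - α • g = θ + (-α) • g := by rw [neg_smul, sub_eq_add_neg]
  have eg : M.lossGrad d (θ + (-α) • g) θ' = M.lossGrad d θ θ' + (-α) • M.reg d g := by
    rw [M.lossGrad_eq d hη, M.lossGrad_eq d hη, reg_add, reg_smul]; abel
  rw [e, M.loss_add, M.poisson_add d hη hirr, poissonLin_smul, eg, ← M.lossGrad_eq d hη,
    reg_smul, remainder]
  simp only [inner_add_left, inner_add_right, inner_smul_left, inner_smul_right, conj_trivial]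
  ring

/-- Averaging `loss_step` over the next pair, Poisson's equation converts the mean of ⟨∇L, g⟩ into
‖∇L‖² and two terms in V. The one at the next pair, with old parameter, cancels its counterpart in
`loss_step`. -/
theorem expected_descent_of_remainder_le (hη : 0 < M.η) (hirr : M.stepMatrix.IsIrreducible)
    (hd : M.IsStationary d) (y : S × A) {α B C : ℝ} (hα0 : 0 ≤ α)
    (θ θ' : EuclideanSpace ℝ (Fin h)) (x : S × A)
    (hrem : ∀ z : S × A, α * M.remainder d y α (M.lossGrad d θ θ') (M.sgrad θ θ' x z.1)
      (M.poisson d y θ θ' z) z ≤ ‖M.lossGrad d θ θ'‖ ^ 2 - C + α * B) :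
    ∑ z, M.stepMatrix x z * M.loss d (θ - α • M.sgrad θ θ' x z.1) θ' - M.loss d θ θ'
      ≤ -α * (inner ℝ (M.lossGrad d θ θ') (M.poisson d y θ θ' x)
          - ∑ z, M.stepMatrix x z * inner ℝ (M.lossGrad d (θ - α • M.sgrad θ θ' x z.1) θ')
              (M.poisson d y (θ - α • M.sgrad θ θ' x z.1) θ' z))
        - α * C + α ^ 2 * B := by
  have hp := M.sum_stepMatrix x
  have h1 : ∑ z, M.stepMatrix x z * M.loss d (θ - α • M.sgrad θ θ' x z.1) θ' - M.loss d θ θ'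
      = ∑ z, M.stepMatrix x z * (M.loss d (θ - α • M.sgrad θ θ' x z.1) θ' - M.loss d θ θ') := by
    simp only [mul_sub, Finset.sum_sub_distrib, ← Finset.sum_mul, hp, one_mul]
  have hmean : ∑ z, M.stepMatrix x z * inner ℝ (M.lossGrad d θ θ') (M.sgrad θ θ' x z.1)
      = ‖M.lossGrad d θ θ'‖ ^ 2 + inner ℝ (M.lossGrad d θ θ') (M.poisson d y θ θ' x)
        - ∑ z, M.stepMatrix x z * inner ℝ (M.lossGrad d θ θ') (M.poisson d y θ θ' z) := by
    have h2 := M.sum_stepMatrix_fst x (M.sgrad θ θ' x)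
    have h3 : ∑ z, M.stepMatrix x z • M.sgrad θ θ' x z.1 = M.meanGrad θ θ' x := h2
    rw [M.poisson_step d hη hirr hd y] at h3
    have h4 := congrArg (fun v => inner ℝ (M.lossGrad d θ θ') v) h3
    simpa only [inner_sum, inner_smul_right, inner_add_right, inner_sub_right,
      real_inner_self_eq_norm_sq] using h4
  set n2 := ‖M.lossGrad d θ θ'‖ ^ 2 with hn2
  have h5 : ∀ z : S × A,
      M.stepMatrix x z * (M.loss d (θ - α • M.sgrad θ θ' x z.1) θ' - M.loss d θ θ')
      ≤ -α * (M.stepMatrix x z * inner ℝ (M.lossGrad d θ θ') (M.sgrad θ θ' x z.1))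
        + α * (M.stepMatrix x z * inner ℝ (M.lossGrad d (θ - α • M.sgrad θ θ' x z.1) θ')
              (M.poisson d y (θ - α • M.sgrad θ θ' x z.1) θ' z))
        - α * (M.stepMatrix x z * inner ℝ (M.lossGrad d θ θ') (M.poisson d y θ θ' z))
        + M.stepMatrix x z * (α * (n2 - C + α * B)) := by
    intro z
    rw [M.loss_step d hη hirr y α θ θ' _ z]
    have h6 := mul_le_mul_of_nonneg_left (mul_le_mul_of_nonneg_left (hrem z) hα0)
      (M.stepMatrix_nonneg x z)
    linarith only [h6]
  rw [h1]
  refine (Finset.sum_le_sum fun z _ => h5 z).trans (le_of_eq ?_)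
  rw [Finset.sum_add_distrib, Finset.sum_sub_distrib, Finset.sum_add_distrib, ← Finset.mul_sum,
    ← Finset.mul_sum, ← Finset.mul_sum, ← Finset.sum_mul, hp, hmean]
  ring

end Descent

end Model

/-! ### Estimate of the remainder and descent from a fixed pair -/

namespace Model

variable {S A : Type*} {h : ℕ} (M : Model S A h)

lemma norm_sgrad_le (hη : 0 < M.η) (hfeat : ∀ s a, ‖M.feat s a‖ ≤ 1) (θm v θ' :
    EuclideanSpace ℝ (Fin h)) (x : S × A) (s' : S) {m : ℝ} (h1 : |M.sampleTarget θ' x s'| ≤ m)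
    (h2 : M.η * ‖θm‖ ≤ m) :
    ‖M.sgrad (θm + v) θ' x s'‖ ≤ (1 + M.η) * ‖v‖ + (2 * m + |M.lin θm x|) := by
  have e : M.sgrad (θm + v) θ' x s'
      = (M.lin θm x + M.lin v x - M.sampleTarget θ' x s') • M.feat x.1 x.2
        + (M.η • θm + M.η • v) := by
    rw [← smul_add]
    simp only [sgrad, lin, sampleTarget, smul_neg, ← neg_smul, inner_add_right]
    congr 2; ring
  have h3 : ‖(M.lin θm x + M.lin v x - M.sampleTarget θ' x s') • M.feat x.1 x.2‖
      ≤ |M.lin θm x| + ‖v‖ + m := by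
    rw [norm_smul]
    refine (mul_le_of_le_one_right (norm_nonneg _) (hfeat _ _)).trans ?_
    refine (abs_sub _ _).trans (add_le_add ((abs_add_le _ _).trans ?_) h1)
    exact add_le_add le_rfl (M.abs_lin_le hfeat v x)
  have h4 : ‖M.η • θm + M.η • v‖ ≤ M.η * ‖θm‖ + M.η * ‖v‖ := by
    refine (norm_add_le _ _).trans ?_
    rw [norm_smul, norm_smul, Real.norm_of_nonneg hη.le]
  rw [e]
  refine (norm_add_le _ _).trans ((add_le_add h3 h4).trans ?_)
  linarith

variable [Fintype S]

lemma sigmaSq_nonneg (θ : EuclideanSpace ℝ (Fin h)) : 0 ≤ M.sigmaSq θ :=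
  Real.iSup_nonneg fun _ => Finset.sum_nonneg fun _ _ =>
    mul_nonneg ENNReal.toReal_nonneg (sq_nonneg _)

variable [Fintype A] (d : PMF (S × A)) [MeasurableSpace S] [DiscreteMeasurableSpace S]
  [MeasurableSpace A] [DiscreteMeasurableSpace A]

/-- The bound on `r + γ max_u φᵀ θ'` in terms of the distance of `θ'` to `θs`. -/
def targetBound (Rmax : ℝ) (θs θ' : EuclideanSpace ℝ (Fin h)) : ℝ :=
  Rmax + M.γ * ‖M.lin θs‖ + M.γ * ‖M.lin (θ' - θs)‖

/-- V is split along θm + v: its part at θm is bounded by the residual, hence by `m`, and its linear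
part by the energy `Z` of `v`. -/
lemma remainder_le (hη : 0 < M.η) (hfeat : ∀ s a, ‖M.feat s a‖ ≤ 1)
    (hirr : M.stepMatrix.IsIrreducible) (hd : M.IsStationary d) (y z : S × A) {α m Z s : ℝ}
    (hα0 : 0 ≤ α) (hm : 0 ≤ m) (hZ : 0 ≤ Z) (hs0 : 0 ≤ s) (hs : s ^ 2 = M.ell d)
    (θm v θ' b g : EuclideanSpace ℝ (Fin h))
    (hθm : ∑ x, (d x).toReal * (M.lin θm x - M.bellman θ' x) ^ 2 ≤ m ^ 2)
    (hv : ∑ x, (d x).toReal * M.lin v x ^ 2 ≤ Z ^ 2) :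
    M.remainder d y α b g (M.poisson d y (θm + v) θ' z) z
      ≤ 3 / 2 * (M.ell d * M.tauMax * ‖g‖ * (m + Z)) + 3 / 2 * (M.tauMax * s * ‖b‖ * ‖g‖)
        + 3 / 2 * (α * M.ell d * M.tauMax * ‖g‖ ^ 2) + M.ell d * ‖g‖ ^ 2 / 2 := by
  have hl : 0 < M.ell d := hη.trans_le ((M.eta_le_mu d).trans (M.mu_le_ell d))
  have hT : 0 ≤ M.tauMax := zero_le_one.trans (M.one_le_tauMax hirr y)
  have hV : ‖M.poisson d y (θm + v) θ' z‖ ≤ 3 / 2 * (M.tauMax * (m + Z)) := by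
    rw [M.poisson_add d hη hirr]
    refine (norm_add_le _ _).trans ?_
    have h1 := M.norm_poisson_le d hη hfeat hirr hd y z θm θ' hm hθm
    have h2 := M.norm_poissonLin_le d hfeat hirr hd y z v hZ hv
    linarith
  have hW1 : ‖M.poissonLin d y z g‖ ≤ 3 / 2 * (M.tauMax * ‖g‖) :=
    M.norm_poissonLin_le d hfeat hirr hd y z g (norm_nonneg _) (M.sum_lin_sq_le_norm d hfeat g)
  -- The energy version carries √l, to be paired with the gradient `b`; the bound by ‖g‖ above
  -- serves the term that already has a factor `ell` and an extra step size.
  have hW2 : ‖M.poissonLin d y z g‖ ≤ 3 / 2 * (M.tauMax * (s * ‖g‖)) := by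
    refine M.norm_poissonLin_le d hfeat hirr hd y z g (by positivity) ?_
    rw [mul_pow, hs]
    exact (M.sum_lin_sq_le_inner d hη g).trans (M.le_ell_mul d g)
  have hN := M.norm_reg_le d hη g
  have e1 : inner ℝ (M.reg d g) (M.poisson d y (θm + v) θ' z)
      ≤ (M.ell d * ‖g‖) * (3 / 2 * (M.tauMax * (m + Z))) :=
    (real_inner_le_norm _ _).trans (mul_le_mul hN hV (norm_nonneg _) (by positivity))
  have e2 : inner ℝ b (M.poissonLin d y z g) ≤ ‖b‖ * (3 / 2 * (M.tauMax * (s * ‖g‖))) :=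
    (real_inner_le_norm _ _).trans (mul_le_mul_of_nonneg_left hW2 (norm_nonneg _))
  have e3 : -(inner ℝ (M.reg d g) (M.poissonLin d y z g))
      ≤ (M.ell d * ‖g‖) * (3 / 2 * (M.tauMax * ‖g‖)) :=
    (neg_le_abs _).trans ((abs_real_inner_le_norm _ _).trans
      (mul_le_mul hN hW1 (norm_nonneg _) (by positivity)))
  have e4 := mul_le_mul_of_nonneg_left e3 hα0
  have e5 := M.le_ell_mul d g
  unfold remainder
  linarith

/-- The conditional descent inequality from a fixed state-action pair. -/
theorem expected_descent (hγ0 : 0 ≤ M.γ) (hγ1 : M.γ < 1) (hη : 0 < M.η)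
    (hfeat : ∀ s a, ‖M.feat s a‖ ≤ 1) (Rmax : ℝ) (hR : ∀ s a s', |M.reward s a s'| ≤ Rmax)
    (hirr : M.stepMatrix.IsIrreducible) (hd : M.IsStationary d)
    (θs : EuclideanSpace ℝ (Fin h)) (hθs : M.IsRPBESolution d θs) (y : S × A) {α : ℝ}
    (hα0 : 0 ≤ α)
    (hα : α ≤ M.mu d / ((M.D1 d Rmax θs + M.ell d / 2) * M.g1 + 2 * M.D2 d))
    (θ θ' : EuclideanSpace ℝ (Fin h)) (x : S × A) :
    ∑ z, M.stepMatrix x z * M.loss d (θ - α • M.sgrad θ θ' x z.1) θ' - M.loss d θ θ'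
      ≤ -α * (inner ℝ (M.lossGrad d θ θ') (M.poisson d y θ θ' x)
          - ∑ z, M.stepMatrix x z * inner ℝ (M.lossGrad d (θ - α • M.sgrad θ θ' x z.1) θ')
              (M.poisson d y (θ - α • M.sgrad θ θ' x z.1) θ' z))
        - M.mu d * α * (M.loss d θ θ' - M.loss d (M.innerArgmin d θ') θ')
        + α ^ 2 * (M.E1 d Rmax θs * ‖M.lin (θ' - θs)‖ ^ 2 + M.E2 d Rmax θs) := by
  have : Nonempty A := ⟨y.2⟩
  have hμ : 0 < M.mu d := hη.trans_le (M.eta_le_mu d)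
  have hμl := M.mu_le_ell d
  have hl : 0 < M.ell d := hμ.trans_le hμl
  have hηl : M.η ≤ M.ell d := (M.eta_le_mu d).trans hμl
  have hT := M.one_le_tauMax hirr y
  have hT0 : 0 < M.tauMax := one_pos.trans_le hT
  have hR0 : 0 ≤ Rmax := (abs_nonneg _).trans (hR x.1 x.2 x.1)
  obtain ⟨θm, hθm⟩ := M.exists_reg_eq d hη (M.proj d (M.bellman θ'))
  obtain ⟨v, rfl⟩ : ∃ v, θ = θm + v := ⟨θ - θm, by abel⟩
  set m := M.targetBound Rmax θs θ' with hm_def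
  have hm0 : 0 ≤ m := by rw [hm_def, targetBound]; positivity
  have hgrad : M.lossGrad d (θm + v) θ' = M.reg d v := by
    rw [M.lossGrad_eq d hη, reg_add, hθm]; abel
  -- the regularized least-squares solution
  have hen := M.reg_eq_proj_energy d hθm
  have hu : ∑ x, (d x).toReal * M.bellman θ' x ^ 2 ≤ m ^ 2 :=
    sum_pmf_mul_sq_le d _ fun x => M.abs_bellman_le hγ0 hR θ' θs x
  have hQm0 := M.inner_reg_self_nonneg d hη θm
  have hη2 : 0 ≤ M.η * ‖θm‖ ^ 2 := by positivity
  have hres0 : 0 ≤ ∑ x, (d x).toReal * (M.bellman θ' x - M.lin θm x) ^ 2 :=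
    Finset.sum_nonneg fun _ _ => mul_nonneg ENNReal.toReal_nonneg (sq_nonneg _)
  have hres : ∑ x, (d x).toReal * (M.bellman θ' x - M.lin θm x) ^ 2 ≤ m ^ 2 := by linarith
  have hQm : inner ℝ (M.reg d θm) θm ≤ m ^ 2 := by linarith
  -- The normal equation reads η θm = ΦᵀD(𝒯Φθ' - Φθm), and the residual is already bounded by `m`.
  have hηθ : M.η * ‖θm‖ ≤ m := by
    have h1 : M.η • θm = M.proj d (fun x => M.bellman θ' x - M.lin θm x) := by
      have h2 : M.proj d (fun x => M.bellman θ' x - M.lin θm x)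
          = M.proj d (M.bellman θ') - M.proj d (M.lin θm) := by
        simp only [proj, sub_smul, smul_sub, Finset.sum_sub_distrib]
      rw [h2, ← hθm, reg, proj]; abel
    have h2 := M.sq_norm_proj_le d hfeat fun x => M.bellman θ' x - M.lin θm x
    rw [← h1, norm_smul, Real.norm_of_nonneg hη.le] at h2
    exact le_of_sq_le_sq (h2.trans hres) hm0
  have hμq : M.mu d * |M.lin θm x| ^ 2 ≤ m ^ 2 := by
    refine le_trans ?_ ((M.mu_mul_le d θm).trans hQm)
    exact mul_le_mul_of_nonneg_left
      (pow_le_pow_left₀ (abs_nonneg _) (M.abs_lin_le hfeat θm x) 2) hμ.le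
  -- Keeping a single term of the stationary sum costs 1 / d(x), which is at most `tauMax` by Kac's
  -- formula.
  have hTq : |M.lin θm x| ^ 2 ≤ M.tauMax * m ^ 2 := by
    have h1 : (d x).toReal * M.lin θm x ^ 2 ≤ m ^ 2 :=
      (Finset.single_le_sum (f := fun x => (d x).toReal * M.lin θm x ^ 2)
        (fun _ _ => mul_nonneg ENNReal.toReal_nonneg (sq_nonneg _)) (Finset.mem_univ x)).trans
        ((M.sum_lin_sq_le_inner d hη θm).trans hQm)
    have h2 := mul_le_mul_of_nonneg_right (M.one_le_tauMax_mul d hirr hd x)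
      (sq_nonneg (M.lin θm x))
    have h3 := mul_le_mul_of_nonneg_left h1 hT0.le
    rw [sq_abs]; linarith
  -- Both points solve normal equations, with data 𝒯Φθ' and 𝒯Φθs. Their difference solves one whose
  -- data are at most γ‖Φ(θ' - θs)‖_∞.
  have hw : M.mu d * ‖θm - θs‖ ^ 2 ≤ (M.γ * ‖M.lin (θ' - θs)‖) ^ 2 := by
    have h1 : M.reg d (θm - θs) = M.proj d (fun x => M.bellman θ' x - M.bellman θs x) := by
      rw [reg_sub, hθm, M.isRPBESolution_reg d hη hθs]
      simp only [proj, sub_smul, smul_sub, Finset.sum_sub_distrib]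
    have h2 := M.reg_eq_proj_energy d h1
    have h3 := sum_pmf_mul_sq_le d _ fun x => M.abs_bellman_sub_le hγ0 θ' θs x
    have h4 : 0 ≤ ∑ x, (d x).toReal
        * ((M.bellman θ' x - M.bellman θs x) - M.lin (θm - θs) x) ^ 2 :=
      Finset.sum_nonneg fun _ _ => mul_nonneg ENNReal.toReal_nonneg (sq_nonneg _)
    have h5 : 0 ≤ M.η * ‖θm - θs‖ ^ 2 := by positivity
    have h6 := M.mu_mul_le d (θm - θs)
    linarith
  have hq : |M.lin θm x| ≤ ‖θs‖ + ‖θm - θs‖ :=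
    (M.abs_lin_le hfeat θm x).trans (by
      have := norm_add_le θs (θm - θs)
      rwa [add_sub_cancel] at this)
  -- constants
  have hlV2 : 0 ≤ M.lV2 := zero_le_one.trans (le_max_right _ _)
  have hlV3 : M.tauMax * ‖θs‖ ≤ M.lV3 Rmax θs := by
    unfold lV3
    refine mul_le_mul_of_nonneg_left ?_ hT0.le
    have : 0 ≤ (M.γ + M.η) * ‖θs‖ := by positivity
    linarith
  have hbud := budget_le (D1 := M.D1 d Rmax θs) (κ := M.kappa d) (lV1 := M.lV1) hμ hμl hT
    (by linarith : 1 ≤ 1 + M.η) hγ0 hγ1.le hR0 (norm_nonneg (M.lin θs))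
    (norm_nonneg (M.lin (θ' - θs))) (norm_nonneg θs) (M.sigmaSq_nonneg θs) hm_def hq hw rfl hlV2
    hlV3 rfl rfl rfl
  have hB : 40 * (M.ell d * M.tauMax * (1 + M.η) ^ 2 * m ^ 2)
      + 3 / 2 * (M.ell d * M.tauMax * m * |M.lin θm x|)
      ≤ M.E1 d Rmax θs * ‖M.lin (θ' - θs)‖ ^ 2 + M.E2 d Rmax θs := by
    refine hbud.trans (le_of_eq ?_)
    simp only [E1, E2, D3, g2, g3]
    ring
  have hκ : M.kappa d * M.mu d = M.ell d := div_mul_cancel₀ _ hμ.ne'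
  have hκ0 : 0 < M.kappa d := div_pos hl hμ
  -- This comes from the summand 2 D₂ = 16 κ τ_max (1 + η)(1 + l) of the denominator: multiply by μ
  -- and use κ μ = l.
  have hstep : α * (16 * (M.ell d * M.tauMax * (1 + M.η) * (1 + M.ell d))) ≤ M.mu d ^ 2 := by
    have hlV1 : 0 < M.lV1 := by unfold lV1; positivity
    have hlV30 : 0 ≤ M.lV3 Rmax θs := le_trans (by positivity) hlV3
    have hD1 : 0 ≤ M.D1 d Rmax θs := by unfold D1; positivity
    have hg1 : 0 ≤ M.g1 := by unfold g1; positivity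
    have hD2 : 0 < M.D2 d := by unfold D2; positivity
    have h1 : 0 ≤ (M.D1 d Rmax θs + M.ell d / 2) * M.g1 := by positivity
    rw [le_div_iff₀ (by positivity)] at hα
    have h2 : α * (2 * M.D2 d) ≤ M.mu d := by
      have := mul_nonneg hα0 h1
      linarith
    have h3 := mul_le_mul_of_nonneg_right h2 hμ.le
    have h4 : α * (2 * M.D2 d) * M.mu d
        = α * (16 * (M.kappa d * M.mu d * M.tauMax * (1 + M.η) * (1 + M.ell d))) := by
      unfold D2 lV1; ring
    rw [h4, hκ] at h3
    linarith
  have hloss : M.loss d (θm + v) θ' - M.loss d (M.innerArgmin d θ') θ'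
      = 1 / 2 * inner ℝ (M.reg d v) v := by
    have h1 := M.loss_eq_of_reg_eq d hθm (θm + v)
    rw [add_sub_cancel_left] at h1
    rw [M.loss_innerArgmin d hη hθm, h1]
    ring
  have hQ0 := M.inner_reg_self_nonneg d hη v
  -- `C` is μ times the excess loss. As ‖∇L‖² ≥ 2 C, it uses half of the squared gradient and leaves
  -- half for the errors.
  have hmain := M.expected_descent_of_remainder_le d hη hirr hd y
    (B := M.E1 d Rmax θs * ‖M.lin (θ' - θs)‖ ^ 2 + M.E2 d Rmax θs)
    (C := M.mu d * (1 / 2 * inner ℝ (M.reg d v) v)) hα0 (θm + v) θ' x ?_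
  · rw [hloss]; linarith
  intro z
  rw [hgrad]
  have hZ2 : Real.sqrt (inner ℝ (M.reg d v) v) ^ 2 = inner ℝ (M.reg d v) v := Real.sq_sqrt hQ0
  have hs2 : Real.sqrt (M.ell d) ^ 2 = M.ell d := Real.sq_sqrt hl.le
  have hn2 := M.mu_mul_inner_le d hη v
  have hne : M.mu d * ‖v‖ ≤ ‖M.reg d v‖ := by
    refine le_of_sq_le_sq ?_ (norm_nonneg _)
    have := mul_le_mul_of_nonneg_left (M.mu_mul_le d v) hμ.le
    linarith [mul_pow (M.mu d) ‖v‖ 2]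
  have hrem := M.remainder_le d hη hfeat hirr hd y z hα0 hm0
    (Real.sqrt_nonneg (inner ℝ (M.reg d v) v)) (Real.sqrt_nonneg (M.ell d)) hs2 θm v θ'
    (M.reg d v) (M.sgrad (θm + v) θ' x z.1)
    (by simpa only [← neg_sub (M.bellman θ' _), neg_sq] using hres)
    (by rw [hZ2]; exact M.sum_lin_sq_le_inner d hη v)
  have hg := M.norm_sgrad_le hη hfeat θm v θ' x z.1
    (M.abs_sampleTarget_le hγ0 hR θ' θs x z.1) hηθ
  have herr := step_error_le hμ hμl hT (by linarith : 1 ≤ 1 + M.η) (by linarith) hα0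
    (norm_nonneg (M.reg d v)) (norm_nonneg v) (Real.sqrt_nonneg (inner ℝ (M.reg d v) v))
    (norm_nonneg (M.sgrad (θm + v) θ' x z.1)) (Real.sqrt_nonneg (M.ell d)) hm0 hs2 hstep hne
    (by rw [hZ2]; exact hn2) hg hμq hTq
  have h1 := mul_le_mul_of_nonneg_left hrem hα0
  have h2 := mul_le_mul_of_nonneg_left hB hα0
  linarith only [h1, h2, herr, hn2]

end Model

/-! ### Measurability and integrability of the iterates -/

lemma measurable_apply_of_countable {Ω X Y : Type*} [MeasurableSpace Ω] [MeasurableSpace X]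
    [MeasurableSpace Y] [Countable X] [MeasurableSingletonClass X] {f : X → Ω → Y}
    (hf : ∀ z, Measurable (f z)) {g : Ω → X} (hg : Measurable g) :
    Measurable fun ω => f (g ω) ω :=
  (measurable_from_prod_countable_right (f := fun p : X × Ω => f p.1 p.2) hf).comp
    (hg.prodMk measurable_id)

lemma memLp_smul_const {Ω E : Type*} [MeasurableSpace Ω] {P : Measure Ω} [NormedAddCommGroup E]
    [NormedSpace ℝ E] {p : ENNReal} {f : Ω → ℝ} (hf : MemLp f p P) (c : E) :
    MemLp (fun ω => f ω • c) p P :=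
  (ContinuousLinearMap.toSpanSingleton ℝ c).comp_memLp' hf

lemma memLp_const_smul_fun {Ω E : Type*} [MeasurableSpace Ω] {P : Measure Ω}
    [NormedAddCommGroup E] [NormedSpace ℝ E] {p : ENNReal} {f : Ω → E} (hf : MemLp f p P) (c : ℝ) :
    MemLp (fun ω => c • f ω) p P :=
  hf.const_smul c

lemma memLp_sub_fun {Ω E : Type*} [MeasurableSpace Ω] {P : Measure Ω} [NormedAddCommGroup E]
    {p : ENNReal} {f g : Ω → E} (hf : MemLp f p P) (hg : MemLp g p P) :
    MemLp (fun ω => f ω - g ω) p P :=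
  hf.sub hg

lemma memLp_add_fun {Ω E : Type*} [MeasurableSpace Ω] {P : Measure Ω} [NormedAddCommGroup E]
    {p : ENNReal} {f g : Ω → E} (hf : MemLp f p P) (hg : MemLp g p P) :
    MemLp (fun ω => f ω + g ω) p P :=
  hf.add hg

lemma integrable_inner_of_memLp {Ω E : Type*} [MeasurableSpace Ω] {P : Measure Ω}
    [NormedAddCommGroup E] [InnerProductSpace ℝ E] {f g : Ω → E} (hf : MemLp f 2 P)
    (hg : MemLp g 2 P) : Integrable (fun ω => inner ℝ (f ω) (g ω)) P :=
  (hf.norm.integrable_mul hg.norm).mono' (hf.1.inner hg.1)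
    (Filter.Eventually.of_forall fun _ => abs_real_inner_le_norm _ _)

/-- Conditional expectation of `Ψ (Y, ·)` for a finite-valued `Y` with known conditional law. -/
lemma condExp_apply_of_finite {Ω X : Type*} [Fintype X] {m m0 : MeasurableSpace Ω}
    {P : Measure Ω} [IsFiniteMeasure P] [MeasurableSpace X] [MeasurableSingletonClass X]
    {Y : Ω → X} (hY : Measurable[m0] Y) {Ψ p : X → Ω → ℝ}
    (hΨ : ∀ z, StronglyMeasurable[m] (Ψ z)) (hint : ∀ z, Integrable (Ψ z) P)
    (hp : ∀ z, P[(Y ⁻¹' {z}).indicator (fun _ => (1 : ℝ)) | m] =ᵐ[P] p z) :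
    Integrable (fun ω => Ψ (Y ω) ω) P ∧
      P[fun ω => Ψ (Y ω) ω | m] =ᵐ[P] fun ω => ∑ z, p z ω * Ψ z ω := by
  classical
  have hmeas : ∀ z, MeasurableSet[m0] (Y ⁻¹' {z}) := fun z => hY (measurableSet_singleton z)
  -- Splitting by the value of `Y` leaves factors `Ψ z` known given `m`, which can be pulled out of
  -- the conditional expectation.
  have e : (fun ω => Ψ (Y ω) ω)
      = ∑ z, Ψ z * (Y ⁻¹' {z}).indicator (fun _ => (1 : ℝ)) := by
    funext ω
    rw [Finset.sum_apply, Finset.sum_eq_single (Y ω)]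
    · simp
    · intro z _ hz
      simp [hz.symm]
    · simp
  have hi : ∀ z, Integrable (Ψ z * (Y ⁻¹' {z}).indicator (fun _ => (1 : ℝ))) P := by
    intro z
    have : Ψ z * (Y ⁻¹' {z}).indicator (fun _ => (1 : ℝ)) = (Y ⁻¹' {z}).indicator (Ψ z) := by
      funext ω
      by_cases hω : ω ∈ Y ⁻¹' {z} <;> simp [hω]
    rw [this]
    exact (hint z).indicator (hmeas z)
  have h1 : ∀ z, P[Ψ z * (Y ⁻¹' {z}).indicator (fun _ => (1 : ℝ)) | m] =ᵐ[P] Ψ z * p z := by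
    intro z
    refine (condExp_mul_of_stronglyMeasurable_left (hΨ z) (hi z)
      ((integrable_const _).indicator (hmeas z))).trans ?_
    filter_upwards [hp z] with ω hω
    simp [hω]
  rw [e]
  refine ⟨integrable_finsetSum' _ fun z _ => hi z, (condExp_finsetSum (fun z _ => hi z) m).trans ?_⟩
  filter_upwards [ae_all_iff.2 h1] with ω hω
  rw [Finset.sum_apply]
  exact Finset.sum_congr rfl fun z _ => by rw [hω z, Pi.mul_apply, mul_comm]

/-! ### Regularity of the loss, its gradient and the Poisson solution in the parameters -/

namespace Model

variable {S A : Type*} {h : ℕ} (M : Model S A h)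

@[fun_prop]
lemma continuous_lin (x : S × A) : Continuous fun θ => M.lin θ x := by
  unfold lin; fun_prop

variable [Fintype S] [Fintype A]

lemma lossGrad_eq_sum (d : PMF (S × A)) (hη : 0 < M.η) (θ θ' : EuclideanSpace ℝ (Fin h)) :
    M.lossGrad d θ θ' = ∑ x, (d x).toReal • ((M.lin θ x - M.bellman θ' x) • M.feat x.1 x.2)
      + M.η • θ := by
  rw [M.lossGrad_eq d hη, reg, proj]
  simp only [sub_smul, smul_sub, Finset.sum_sub_distrib]
  abel

section Continuity

lemma continuous_maxVal [Nonempty A] (hfeat : ∀ s a, ‖M.feat s a‖ ≤ 1) (s : S) :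
    Continuous fun θ => M.maxVal θ s := by
  refine (LipschitzWith.of_dist_le_mul (K := 1) fun θ θ' => ?_).continuous
  rw [Real.dist_eq, dist_eq_norm, NNReal.coe_one, one_mul]
  refine (M.abs_maxVal_sub_le θ θ' s).trans ?_
  exact (pi_norm_le_iff_of_nonneg (norm_nonneg _)).2 fun x => M.abs_lin_le hfeat _ x

lemma continuous_sgrad [Nonempty A] (hfeat : ∀ s a, ‖M.feat s a‖ ≤ 1) (x : S × A) (s' : S) :
    Continuous fun p : EuclideanSpace ℝ (Fin h) × EuclideanSpace ℝ (Fin h) =>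
      M.sgrad p.1 p.2 x s' := by
  have := (M.continuous_maxVal hfeat s').comp continuous_snd
    (X := EuclideanSpace ℝ (Fin h) × EuclideanSpace ℝ (Fin h))
  simp only [Function.comp_def] at this
  unfold sgrad; fun_prop

lemma continuous_bellman [Nonempty A] (hfeat : ∀ s a, ‖M.feat s a‖ ≤ 1) (x : S × A) :
    Continuous fun θ => M.bellman θ x := by
  have := M.continuous_maxVal hfeat
  unfold bellman; fun_prop

end Continuity

section Integrability

variable {Ω : Type*} [MeasurableSpace Ω] {P : Measure Ω} [IsProbabilityMeasure P] [Nonempty A]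
  {U Θ' : Ω → EuclideanSpace ℝ (Fin h)}

lemma measurable_sgrad_apply [MeasurableSpace S] [DiscreteMeasurableSpace S] [MeasurableSpace A]
    [DiscreteMeasurableSpace A] (hfeat : ∀ s a, ‖M.feat s a‖ ≤ 1) (hU : Measurable U)
    (hΘ' : Measurable Θ') {X X' : Ω → S × A} (hX : Measurable X) (hX' : Measurable X') :
    Measurable fun ω => M.sgrad (U ω) (Θ' ω) (X ω) (X' ω).1 := by
  have h1 : ∀ p : (S × A) × (S × A),
      Measurable fun ω => M.sgrad (U ω) (Θ' ω) p.1 p.2.1 := fun p =>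
    Continuous.measurable2 (c := fun a b => M.sgrad a b p.1 p.2.1)
      (M.continuous_sgrad hfeat p.1 p.2.1) hU hΘ'
  have h2 : Measurable fun ω => (X ω, X' ω) := hX.prodMk hX'
  have h3 := measurable_apply_of_countable h1 h2
  exact h3

lemma measurable_sub_smul_sgrad [MeasurableSpace S] [DiscreteMeasurableSpace S]
    [MeasurableSpace A] [DiscreteMeasurableSpace A] (hfeat : ∀ s a, ‖M.feat s a‖ ≤ 1)
    (hU : Measurable U) (hΘ' : Measurable Θ') {X X' : Ω → S × A} (hX : Measurable X)
    (hX' : Measurable X') (a : ℝ) :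
    Measurable fun ω => U ω - a • M.sgrad (U ω) (Θ' ω) (X ω) (X' ω).1 :=
  hU.sub ((M.measurable_sgrad_apply hfeat hU hΘ' hX hX').const_smul a)

lemma abs_maxVal_le_norm (hfeat : ∀ s a, ‖M.feat s a‖ ≤ 1) (θ : EuclideanSpace ℝ (Fin h))
    (s : S) : |M.maxVal θ s| ≤ ‖θ‖ :=
  (M.abs_maxVal_le θ s).trans
    ((pi_norm_le_iff_of_nonneg (norm_nonneg _)).2 fun x => M.abs_lin_le hfeat _ x)

lemma memLp_sgrad_apply [MeasurableSpace S] [DiscreteMeasurableSpace S] [MeasurableSpace A]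
    [DiscreteMeasurableSpace A] (hη : 0 < M.η) (hγ0 : 0 ≤ M.γ)
    (hfeat : ∀ s a, ‖M.feat s a‖ ≤ 1) {Rmax : ℝ} (hR : ∀ s a s', |M.reward s a s'| ≤ Rmax)
    (hU : Measurable U) (hΘ' : Measurable Θ') (hU2 : MemLp U 2 P) (hΘ'2 : MemLp Θ' 2 P)
    {X X' : Ω → S × A} (hX : Measurable X) (hX' : Measurable X') :
    MemLp (fun ω => M.sgrad (U ω) (Θ' ω) (X ω) (X' ω).1) 2 P := by
  have hdom : MemLp (fun ω => (1 + M.η) * ‖U ω‖ + (Rmax + M.γ * ‖Θ' ω‖)) 2 P :=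
    memLp_add_fun (hU2.norm.const_mul (1 + M.η))
      (memLp_add_fun (memLp_const Rmax) (hΘ'2.norm.const_mul M.γ))
  refine hdom.mono' (M.measurable_sgrad_apply hfeat hU hΘ' hX hX').aestronglyMeasurable
    (Filter.Eventually.of_forall fun ω => ?_)
  have h1 : |M.reward (X ω).1 (X ω).2 (X' ω).1 + M.γ * M.maxVal (Θ' ω) (X' ω).1
      - inner ℝ (M.feat (X ω).1 (X ω).2) (U ω)| ≤ Rmax + M.γ * ‖Θ' ω‖ + ‖U ω‖ := by
    refine (abs_sub _ _).trans (add_le_add ((abs_add_le _ _).trans (add_le_add (hR _ _ _) ?_)) ?_)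
    · rw [abs_mul, abs_of_nonneg hγ0]
      exact mul_le_mul_of_nonneg_left (M.abs_maxVal_le_norm hfeat _ _) hγ0
    · exact M.abs_lin_le hfeat (U ω) (X ω)
  calc ‖M.sgrad (U ω) (Θ' ω) (X ω) (X' ω).1‖
      ≤ (Rmax + M.γ * ‖Θ' ω‖ + ‖U ω‖) + M.η * ‖U ω‖ := by
        refine (norm_add_le _ _).trans (add_le_add ?_ ?_)
        · rw [norm_smul, norm_neg]
          exact (mul_le_of_le_one_right (norm_nonneg _) (hfeat _ _)).trans h1
        · rw [norm_smul, Real.norm_of_nonneg hη.le]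
    _ = _ := by ring

lemma memLp_lin_sub_bellman (hγ0 : 0 ≤ M.γ)
    (hfeat : ∀ s a, ‖M.feat s a‖ ≤ 1) {Rmax : ℝ} (hR : ∀ s a s', |M.reward s a s'| ≤ Rmax)
    (hΘ' : Measurable Θ') (hU2 : MemLp U 2 P) (hΘ'2 : MemLp Θ' 2 P)
    (x : S × A) : MemLp (fun ω => M.lin (U ω) x - M.bellman (Θ' ω) x) 2 P := by
  have hdom : MemLp (fun ω => Rmax + M.γ * ‖Θ' ω‖) 2 P :=
    memLp_add_fun (memLp_const Rmax) (hΘ'2.norm.const_mul M.γ)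
  refine memLp_sub_fun (hU2.const_inner _) (hdom.mono'
    ((M.continuous_bellman hfeat x).measurable.comp hΘ').aestronglyMeasurable
    (Filter.Eventually.of_forall fun ω => ?_))
  refine abs_sum_pmf_mul_le _ _ fun s' => (abs_add_le _ _).trans (add_le_add (hR _ _ _) ?_)
  rw [abs_mul, abs_of_nonneg hγ0]
  exact mul_le_mul_of_nonneg_left (M.abs_maxVal_le_norm hfeat _ _) hγ0

variable (d : PMF (S × A))

lemma integrable_loss (hγ0 : 0 ≤ M.γ)
    (hfeat : ∀ s a, ‖M.feat s a‖ ≤ 1) {Rmax : ℝ} (hR : ∀ s a s', |M.reward s a s'| ≤ Rmax)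
    (hΘ' : Measurable Θ') (hU2 : MemLp U 2 P) (hΘ'2 : MemLp Θ' 2 P) :
    Integrable (fun ω => M.loss d (U ω) (Θ' ω)) P := by
  refine ((integrable_finsetSum _ fun x _ => ?_).const_mul _).add (Integrable.const_mul ?_ _)
  · have h1 := (M.memLp_lin_sub_bellman hγ0 hfeat hR hΘ' hU2 hΘ'2 x).integrable_sq
    simp only [← neg_sub (M.bellman _ _), neg_sq] at h1
    exact h1.const_mul _
  · exact hU2.norm.integrable_sq

lemma memLp_lossGrad (hη : 0 < M.η) (hγ0 : 0 ≤ M.γ)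
    (hfeat : ∀ s a, ‖M.feat s a‖ ≤ 1) {Rmax : ℝ} (hR : ∀ s a s', |M.reward s a s'| ≤ Rmax)
    (hΘ' : Measurable Θ') (hU2 : MemLp U 2 P) (hΘ'2 : MemLp Θ' 2 P) :
    MemLp (fun ω => M.lossGrad d (U ω) (Θ' ω)) 2 P := by
  simp only [M.lossGrad_eq_sum d hη]
  refine memLp_add_fun (memLp_finsetSum _ fun x _ => memLp_const_smul_fun ?_ _)
    (memLp_const_smul_fun hU2 _)
  exact memLp_smul_const (M.memLp_lin_sub_bellman hγ0 hfeat hR hΘ' hU2 hΘ'2 x) _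

variable [MeasurableSpace S] [DiscreteMeasurableSpace S]
  [MeasurableSpace A] [DiscreteMeasurableSpace A]

lemma memLp_poisson (hη : 0 < M.η) (hγ0 : 0 ≤ M.γ)
    (hfeat : ∀ s a, ‖M.feat s a‖ ≤ 1) {Rmax : ℝ} (hR : ∀ s a s', |M.reward s a s'| ≤ Rmax)
    (hirr : M.stepMatrix.IsIrreducible) (y z : S × A)
    (hΘ' : Measurable Θ') (hU2 : MemLp U 2 P) (hΘ'2 : MemLp Θ' 2 P) :
    MemLp (fun ω => M.poisson d y (U ω) (Θ' ω) z) 2 P := by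
  have h1 := M.memLp_lin_sub_bellman hγ0 hfeat hR hΘ' hU2 hΘ'2
  simp only [M.poisson_eq_sum d hirr, M.meanGrad_sub_lossGrad d hη]
  refine memLp_finsetSum _ fun x _ => memLp_const_smul_fun (memLp_sub_fun ?_ ?_) _
  · exact memLp_smul_const (h1 x) _
  · exact memLp_finsetSum _ fun j _ => memLp_const_smul_fun (memLp_smul_const (h1 j) _) _

end Integrability

section Measurability

variable {Ω : Type*} [MeasurableSpace Ω] [Nonempty A] {U Θ' : Ω → EuclideanSpace ℝ (Fin h)}
  (d : PMF (S × A))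

lemma measurable_loss (hfeat : ∀ s a, ‖M.feat s a‖ ≤ 1) (hU : Measurable U)
    (hΘ' : Measurable Θ') : Measurable fun ω => M.loss d (U ω) (Θ' ω) := by
  have h1 := M.continuous_bellman hfeat
  have h2 : Continuous fun p : EuclideanSpace ℝ (Fin h) × EuclideanSpace ℝ (Fin h) =>
      M.loss d p.1 p.2 := by
    unfold loss; fun_prop
  exact Continuous.measurable2 (c := fun a b => M.loss d a b) h2 hU hΘ'

variable [MeasurableSpace S] [DiscreteMeasurableSpace S]
  [MeasurableSpace A] [DiscreteMeasurableSpace A]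

/-- Once the gradient and the path integral are rewritten as finite sums, joint continuity in the
two parameters is visible. -/
lemma measurable_inner_lossGrad_poisson (hη : 0 < M.η)
    (hfeat : ∀ s a, ‖M.feat s a‖ ≤ 1) (hirr : M.stepMatrix.IsIrreducible) (y z : S × A)
    (hU : Measurable U) (hΘ' : Measurable Θ') :
    Measurable fun ω => inner ℝ (M.lossGrad d (U ω) (Θ' ω)) (M.poisson d y (U ω) (Θ' ω) z) := by
  have h1 := M.continuous_bellman hfeat
  have h2 : Continuous fun p : EuclideanSpace ℝ (Fin h) × EuclideanSpace ℝ (Fin h) =>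
      inner ℝ (M.lossGrad d p.1 p.2) (M.poisson d y p.1 p.2 z) := by
    simp only [M.poisson_eq_sum d hirr, M.lossGrad_eq_sum d hη, M.meanGrad_eq]
    fun_prop
  exact Continuous.measurable2
    (c := fun a b => inner ℝ (M.lossGrad d a b) (M.poisson d y a b z)) h2 hU hΘ'

end Measurability

end Model

/-! ### Measurability and square integrability of the double-loop iterates -/

section Iterates

variable {S A : Type*} {h : ℕ} (M : Model S A h) [Fintype S] [Fintype A] [Nonempty A]
  [MeasurableSpace S] [DiscreteMeasurableSpace S] [MeasurableSpace A] [DiscreteMeasurableSpace A]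
  {Ω : Type*} [MeasurableSpace Ω] {P : Measure Ω} [IsProbabilityMeasure P] (α : ℕ → ℝ)
  {Θ' : Ω → EuclideanSpace ℝ (Fin h)}

lemma measurable_innerIter (hfeat : ∀ s a, ‖M.feat s a‖ ≤ 1) (hΘ' : Measurable Θ')
    {X : ℕ → Ω → S × A} (k : ℕ) (hX : ∀ j ≤ k, Measurable (X j)) :
    Measurable fun ω => innerIter M α (Θ' ω) (fun j => X j ω) k := by
  induction k with
  | zero => exact hΘ'
  | succ k ih =>
    have h1 := ih fun j hj => hX j (by omega)
    exact M.measurable_sub_smul_sgrad hfeat h1 hΘ' (hX k (by omega)) (hX (k + 1) le_rfl) (α k)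

lemma memLp_innerIter (hη : 0 < M.η) (hγ0 : 0 ≤ M.γ)
    (hfeat : ∀ s a, ‖M.feat s a‖ ≤ 1) {Rmax : ℝ} (hR : ∀ s a s', |M.reward s a s'| ≤ Rmax)
    (hΘ' : Measurable Θ') (hΘ'2 : MemLp Θ' 2 P) {X : ℕ → Ω → S × A} (hX : ∀ j, Measurable (X j))
    (k : ℕ) : MemLp (fun ω => innerIter M α (Θ' ω) (fun j => X j ω) k) 2 P := by
  induction k with
  | zero => exact hΘ'2
  | succ k ih =>
    have h1 := measurable_innerIter M α hfeat hΘ' k fun j _ => hX j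
    exact memLp_sub_fun ih (memLp_const_smul_fun
      (M.memLp_sgrad_apply hη hγ0 hfeat hR h1 hΘ' ih hΘ'2 (hX k) (hX (k + 1))) (α k))

variable {θ₀ : Ω → EuclideanSpace ℝ (Fin h)} {K : ℕ} {x : ℕ → ℕ → Ω → S × A}

lemma measurable_outerIter (hfeat : ∀ s a, ‖M.feat s a‖ ≤ 1) (hθ₀ : Measurable θ₀) (t : ℕ)
    (hx : ∀ i j, 1 ≤ i → i ≤ t → j ≤ K → Measurable (x i j)) :
    Measurable fun ω => outerIter M α K (θ₀ ω) (fun i j => x i j ω) t := by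
  induction t with
  | zero => exact hθ₀
  | succ t ih =>
    exact measurable_innerIter M α hfeat (ih fun i j h1 h2 h3 => hx i j h1 (by omega) h3) K
      fun j hj => hx (t + 1) j (by omega) le_rfl hj

lemma memLp_outerIter (hη : 0 < M.η) (hγ0 : 0 ≤ M.γ)
    (hfeat : ∀ s a, ‖M.feat s a‖ ≤ 1) {Rmax : ℝ} (hR : ∀ s a s', |M.reward s a s'| ≤ Rmax)
    (hθ₀ : Measurable θ₀) (hθ₀2 : MemLp θ₀ 2 P) (hx : ∀ i j, Measurable (x i j)) (t : ℕ) :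
    MemLp (fun ω => outerIter M α K (θ₀ ω) (fun i j => x i j ω) t) 2 P := by
  induction t with
  | zero => exact hθ₀2
  | succ t ih =>
    exact memLp_innerIter M α hη hγ0 hfeat hR
      (measurable_outerIter M α hfeat hθ₀ t fun i j _ _ _ => hx i j) ih (hx (t + 1)) K

omit [MeasurableSpace Ω] [Fintype S] [Fintype A] [Nonempty A] [DiscreteMeasurableSpace S]
  [DiscreteMeasurableSpace A] in
lemma measurable_info {t k i j : ℕ} (hi : 1 ≤ i) (hij : i < t ∧ j ≤ K ∨ i = t ∧ j ≤ k) :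
    Measurable[info K θ₀ x t k] (x i j) := by
  rw [measurable_iff_comap_le]
  exact le_sup_of_le_right (le_iSup₂_of_le (i, j) ⟨hi, hij⟩ le_rfl)

omit [MeasurableSpace Ω] [Fintype S] [Fintype A] [Nonempty A] [DiscreteMeasurableSpace S]
  [DiscreteMeasurableSpace A] in
lemma measurable_info_init {t k : ℕ} : Measurable[info K θ₀ x t k] θ₀ := by
  rw [measurable_iff_comap_le]
  exact le_sup_left

end Iterates

end PRQ

end

theorem mainTheorem5 {S A : Type*} [Fintype S] [Fintype A]
    [MeasurableSpace S] [DiscreteMeasurableSpace S]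
    [MeasurableSpace A] [DiscreteMeasurableSpace A] {h : ℕ} (M : PRQ.Model S A h)
    (hγ0 : 0 ≤ M.γ) (hγ1 : M.γ < 1) (hη : 0 < M.η)
    (hfeat : ∀ s a, ‖M.feat s a‖ ≤ 1)
    (Rmax : ℝ) (hR : ∀ s a s', |M.reward s a s'| ≤ Rmax)
    (hirr : M.stepMatrix.IsIrreducible)
    (d : PMF (S × A)) (hd : M.IsStationary d)
    (θs : EuclideanSpace ℝ (Fin h)) (hθs : M.IsRPBESolution d θs)
    (y : S × A)
    {Ω : Type*} [MeasurableSpace Ω] (P : Measure Ω) [IsProbabilityMeasure P]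
    (K : ℕ) (α : ℕ → ℝ)
    (θ₀ : Ω → EuclideanSpace ℝ (Fin h)) (hθ₀ : Measurable θ₀) (hθ₀L2 : MemLp θ₀ 2 P)
    (x : ℕ → ℕ → Ω → S × A) (hx : PRQ.IsMarkovSampling M P K θ₀ x)
    (t k : ℕ) (ht : 1 ≤ t) (hk : k < K)
    (hα0 : 0 ≤ α k)
    (hα : α k ≤ M.mu d / ((M.D1 d Rmax θs + M.ell d / 2) * M.g1 + 2 * M.D2 d)) :
    let path : Ω → ℕ → ℕ → S × A := fun ω i j => x i j ω
    let target : Ω → EuclideanSpace ℝ (Fin h) :=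
      fun ω => PRQ.outerIter M α K (θ₀ ω) (path ω) (t - 1)
    let L : ℕ → Ω → ℝ :=
      fun j ω => M.loss d (PRQ.iter M α K (θ₀ ω) (path ω) t j) (target ω)
    let D : ℕ → Ω → ℝ := fun j ω => PRQ.driftTerm M d y α K (θ₀ ω) (path ω) t j
    Integrable (L (k + 1)) P ∧ Integrable (D (k + 1)) P ∧
      ∀ᵐ ω ∂P,
        (P[L (k + 1) | PRQ.info K θ₀ x t k]) ω - L k ω ≤
          -(α k) * (D k ω - (P[D (k + 1) | PRQ.info K θ₀ x t k]) ω)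
            - M.mu d * α k * (L k ω - M.loss d (M.innerArgmin d (target ω)) (target ω))
            + α k ^ 2 * (M.E1 d Rmax θs * ‖M.lin (target ω - θs)‖ ^ 2 + M.E2 d Rmax θs) := by
  intro path target L D
  have : Nonempty A := ⟨y.2⟩
  obtain ⟨hxm, hxk⟩ := hx
  let Θ : Ω → EuclideanSpace ℝ (Fin h) := fun ω => PRQ.iter M α K (θ₀ ω) (path ω) t k
  -- The next iterate if the next pair were `z`. Freezing `z` makes it measurable with respect to
  -- the history, and putting the sampled pair for `z` recovers the true iterate by definition.
  let U : S × A → Ω → EuclideanSpace ℝ (Fin h) := fun z ω =>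
    Θ ω - α k • M.sgrad (Θ ω) (target ω) (x t k ω) z.1
  -- measurability with respect to the history
  have htargF : Measurable[PRQ.info K θ₀ x t k] target :=
    @PRQ.measurable_outerIter S A h M _ _ _ _ _ _ _ Ω (PRQ.info K θ₀ x t k) α θ₀ K x hfeat
      PRQ.measurable_info_init (t - 1)
      fun i j h1 h2 h3 => PRQ.measurable_info h1 (Or.inl ⟨by omega, h3⟩)
  have hxF : ∀ j ≤ k, Measurable[PRQ.info K θ₀ x t k] (x t j) := fun j hj =>
    PRQ.measurable_info ht (Or.inr ⟨rfl, hj⟩)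
  have hΘF : Measurable[PRQ.info K θ₀ x t k] Θ :=
    @PRQ.measurable_innerIter S A h M _ _ _ _ _ _ _ Ω (PRQ.info K θ₀ x t k) α target hfeat
      htargF (x t) k hxF
  have hUF : ∀ z, Measurable[PRQ.info K θ₀ x t k] (U z) := fun z =>
    @PRQ.Model.measurable_sub_smul_sgrad S A h M _ _ Ω (PRQ.info K θ₀ x t k) _ Θ target
      _ _ _ _ hfeat hΘF htargF _ (fun _ => z) (hxF k le_rfl) measurable_const (α k)
  -- square integrability
  have htarg : Measurable target :=
    PRQ.measurable_outerIter M α hfeat hθ₀ (t - 1) fun i j _ _ _ => hxm i j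
  have htarg2 : MemLp target 2 P :=
    PRQ.memLp_outerIter M α hη hγ0 hfeat hR hθ₀ hθ₀L2 hxm (t - 1)
  have hΘ : Measurable Θ := PRQ.measurable_innerIter M α hfeat htarg k fun j _ => hxm t j
  have hΘ2 : MemLp Θ 2 P := PRQ.memLp_innerIter M α hη hγ0 hfeat hR htarg htarg2 (hxm t) k
  have hU : ∀ z, Measurable (U z) := fun z =>
    M.measurable_sub_smul_sgrad hfeat hΘ htarg (hxm t k) (measurable_const (a := z)) (α k)
  have hU2 : ∀ z, MemLp (U z) 2 P := fun z =>
    PRQ.memLp_sub_fun hΘ2 (PRQ.memLp_const_smul_fun (M.memLp_sgrad_apply hη hγ0 hfeat hR hΘ htarg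
      hΘ2 htarg2 (hxm t k) (measurable_const (a := z))) (α k))
  obtain ⟨hL1, hL2⟩ := PRQ.condExp_apply_of_finite (P := P) (m := PRQ.info K θ₀ x t k)
    (hxm t (k + 1)) (Ψ := fun z ω => M.loss d (U z ω) (target ω))
    (fun z => Measurable.stronglyMeasurable
      (@PRQ.Model.measurable_loss S A h M _ _ Ω (PRQ.info K θ₀ x t k) _ (U z) target d hfeat
        (hUF z) htargF))
    (fun z => M.integrable_loss d hγ0 hfeat hR htarg (hU2 z) htarg2) (hxk t k ht hk)
  obtain ⟨hD1, hD2⟩ := PRQ.condExp_apply_of_finite (P := P) (m := PRQ.info K θ₀ x t k)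
    (hxm t (k + 1))
    (Ψ := fun z ω => inner ℝ (M.lossGrad d (U z ω) (target ω))
      (M.poisson d y (U z ω) (target ω) z))
    (fun z => Measurable.stronglyMeasurable
      (@PRQ.Model.measurable_inner_lossGrad_poisson S A h M _ _ Ω (PRQ.info K θ₀ x t k) _ (U z)
        target d _ _ _ _ hη hfeat hirr y z (hUF z) htargF))
    (fun z => PRQ.integrable_inner_of_memLp
      (M.memLp_lossGrad d hη hγ0 hfeat hR htarg (hU2 z) htarg2)
      (M.memLp_poisson d hη hγ0 hfeat hR hirr y z htarg (hU2 z) htarg2)) (hxk t k ht hk)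
  refine ⟨hL1, hD1, ?_⟩
  filter_upwards [hL2, hD2] with ω hLω hDω
  have hmain := M.expected_descent d hγ0 hγ1 hη hfeat Rmax hR hirr hd θs hθs y hα0 hα (Θ ω)
    (target ω) (x t k ω)
  -- These are definitional unfoldings; for the drift one also uses that the iterate at inner time
  -- 0, the second argument of V, is the target.
  have hLω' : (P[L (k + 1) | PRQ.info K θ₀ x t k]) ω
      = ∑ z, M.stepMatrix (x t k ω) z * M.loss d (U z ω) (target ω) := hLω
  have hDω' : (P[D (k + 1) | PRQ.info K θ₀ x t k]) ω
      = ∑ z, M.stepMatrix (x t k ω) z * inner ℝ (M.lossGrad d (U z ω) (target ω))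
          (M.poisson d y (U z ω) (target ω) z) := hDω
  rw [hLω', hDω']
  exact hmain
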